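/- Let $R$ be a regular local ring containing a field $\Bbbk$ of characteristic zero, let $I_Z=(g_1,\dots,g_k)\subset R$ be generated by a regular sequence, put $\mathcal O_Z=R/I_Z$, $Z=\mathrm{Spec}\,\mathcal O_Z$, and identify $gr_{I_Z}R=\mathcal O_Z[y_1,\dots,y_k]$, the class of $g_i$ in $I_Z/I_Z^2$ being $y_i$. Let $X=V(I_X)\supseteq Z$, i.e. $I_X\subseteq I_Z$. (The main case is $Z=\mathrm{Sing}(X)$, reduced, with $X$ generically ordinary along $Z$; these conditions are not needed for the statement.) The *conormal ideal* $gr(I_X)\subset\mathcal O_Z[y_1,\dots,y_k]$ is the ideal generated by the leading terms of all elements of $I_X$, where an element $f\in I_Z^p\setminus I_Z^{p+1}$, $f=\sum_{|m|=p}a_m g^m$, has order $p$ and leading term $\tilde f=\sum_{|m|=p}a_m|_Z\,y^m$. Assume that $X$ is a strictly complete intersection over $Z$, i.e. that $gr(I_X)$ is generated by a regular sequence, and let $f_1,\dots,f_r$ be a good basis of $I_X$: a regular sequence generating $I_X$, with orders $p_1\le\dots\le p_r$, whose leading terms $\tilde f_1,\dots,\tilde f_r$ form a regular sequence generating $gr(I_X)$.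 Let $\mathbb P\mathcal N=\{gr(I_X)=0\}=\{\tilde f_1=\dots=\tilde f_r=0\}\subset\mathbb P^{k-1}\times Z$ be the projectivized normal cone, $\pi:\mathbb P\mathcal N\to Z$ the projection, and let $Crit(\pi)\subset\mathbb P\mathcal N$ be its critical locus, the closed subscheme with ideal sheaf $Fitt_{k-1-r}(\Omega^1_{\mathbb P\mathcal N/Z})$ (Fitting ideals of negative index are zero). The discriminant of transversal type $\Delta^\perp\subset Z$ is defined as follows. Let $S$ be the affine space over $\Bbbk$ of all coefficients of $r$-tuples of forms $F_1,\dots,F_r$ of degrees $p_1,\dots,p_r$ in $y_1,\dots,y_k$, let $\mathcal X=\{F_1=\dots=F_r=0\}\subset\mathbb P^{k-1}\times S$ be the universal family, $\pi_S:\mathcal X\to S$ its projection, and $Crit(\pi_S)\subset\mathcal X$ the closed subscheme with ideal sheaf $Fitt_{k-1-r}(\Omega^1_{\mathcal X/S})$. The classical discriminant $\Delta\subset S$ is the schematic closure of the subscheme defined by $Fitt_0(\pi_{S*}\mathcal O_{Crit(\pi_S)})$ in the open set of points of $S$ near which $Crit(\pi_S)\to S$ is finite. Then $\Delta^\perp=\phi^*(\Delta)$,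 where $\phi:Z\to S$ is given by the coefficients of $\tilde f_1,\dots,\tilde f_r$; i.e. $I_{\Delta^\perp}\subset\mathcal O_Z$ is generated by the values of the elements of $I_\Delta$ at these coefficients. Then: 1. As a closed subscheme of $\mathbb P^{k-1}\times Z$, $$Crit(\pi)=\Big\{\tilde f_1=\dots=\tilde f_r=0,\ \ \mathrm{rank}\big(d\tilde f_1,\dots,d\tilde f_r\big)<r\Big\},$$ where $d\tilde f_j$ is the $k\times1$ column of partial derivatives of $\tilde f_j$ with respect to the homogeneous coordinates $y_1,\dots,y_k$, and the rank condition means the vanishing of all $r\times r$ minors. 2. If the restriction $Crit(\pi)\to Z$ of $\pi$ is a finite morphism, then the defining ideal of $\Delta^\perp\subset Z$ is $Fitt_0(\pi_*\mathcal O_{Crit(\pi)})\subset\mathcal O_Z$. -/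

import Mathlib

open AlgebraicGeometry CategoryTheory MvPolynomial

noncomputable section

namespace TransversalDiscriminant

universe u v

attribute [local instance] MvPolynomial.gradedAlgebra

/-! ### Fitting ideals -/

/-- The Fitting ideal `Fitt_j(M)` of a finitely generated module: the ideal of minors of size `n - j`
of the matrices of relations between `n` generators of `M`.  (The ideal does not depend on the
generators, so all finite generating families and all relations are allowed at once.  Minors of
size `≤ 0` are `1`; for `j < 0` a choice of more than `n` columns has a repetition, so that all
minors vanish and `Fitt_j(M) = 0`.) -/
def fittingIdeal (A : Type u) [CommRing A] (M : Type v) [AddCommGroup M] [Module A M] (j : ℤ) :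
    Ideal A :=
  Ideal.span {a | ∃ (n : ℕ) (x : Fin n → M),
    Submodule.span A (Set.range x) = ⊤ ∧
    ∃ (ρ : Fin ((n : ℤ) - j).toNat → Fin n → A) (c : Fin ((n : ℤ) - j).toNat → Fin n),
      (∀ i, ∑ l, ρ i l • x l = 0) ∧
      a = Matrix.det (Matrix.of fun i l => ρ i (c l))}

/-! ### Schemes over an affine base: functions, critical locus, image with its Fitting structure -/

section AffineBase

variable {A : Type u} [CommRing A] {X : Scheme.{u}}

/-- The `A`-algebra structure on the functions on an open set of a scheme over `Spec A`. -/
@[reducible] def sectionsAlgebra (π : X ⟶ Spec (CommRingCat.of A)) (U : X.Opens) :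
    Algebra A Γ(X, U) :=
  RingHom.toAlgebra
    ((Scheme.ΓSpecIso (CommRingCat.of A)).inv ≫ π.appTop ≫
      X.presheaf.map (homOfLE (le_top : U ≤ ⊤)).op).hom

/-- The ideal sheaf of the critical locus of `π : X → Spec A` (of relative dimension `d`): it is the
sheaf of Fitting ideals `Fitt_d(Ω¹_{X/A})`, i.e. on an affine open `U` it is
`Fitt_d(Ω¹_{Γ(X,U)/A})`. -/
def criticalIdeal (π : X ⟶ Spec (CommRingCat.of A)) (d : ℤ) : X.IdealSheafData :=
  Scheme.IdealSheafData.ofIdeals fun U =>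
    letI : Algebra A Γ(X, U) := sectionsAlgebra π U
    fittingIdeal Γ(X, U) (Ω[Γ(X, U)⁄A]) d

/-- `Fitt_0(π_* 𝒪_C)` for `π : C → Spec A`. -/
def pushforwardFitting (π : X ⟶ Spec (CommRingCat.of A)) : Ideal A :=
  letI : Algebra A Γ(X, ⊤) := sectionsAlgebra π ⊤
  fittingIdeal A Γ(X, ⊤) 0

/-- The stalk at the point `s` of the ideal sheaf `Fitt_0(π_* 𝒪_C)`. -/
def pushforwardFittingStalk (π : X ⟶ Spec (CommRingCat.of A)) (s : PrimeSpectrum A) :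
    Ideal (Localization.AtPrime s.asIdeal) :=
  letI : Algebra A Γ(X, ⊤) := sectionsAlgebra π ⊤
  fittingIdeal (Localization.AtPrime s.asIdeal)
    (LocalizedModule s.asIdeal.primeCompl Γ(X, ⊤)) 0

/-- The morphism `π` is finite at the point `s` of the base, i.e. over a neighbourhood of `s`. -/
def IsFiniteAt (π : X ⟶ Spec (CommRingCat.of A)) (s : PrimeSpectrum A) : Prop :=
  ∃ U : (Spec (CommRingCat.of A)).Opens, s ∈ U ∧ IsFinite (π ∣_ U)

/-- The ideal of the (schematic) closure in `Spec A` of the subscheme which is defined by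
`Fitt_0(π_* 𝒪_C)` over the open set of points at which `π` is finite: the functions on `Spec A`
whose germ at each such point belongs to the Fitting ideal. -/
def closedFittingImage (π : X ⟶ Spec (CommRingCat.of A)) : Ideal A :=
  ⨅ (s : PrimeSpectrum A) (_ : IsFiniteAt π s),
    (pushforwardFittingStalk π s).comap (algebraMap A (Localization.AtPrime s.asIdeal))

end AffineBase

/-! ### Closed subschemes of `ℙ^{k-1} × Spec A` -/

section Projective

variable (A : Type u) [CommRing A] (k : ℕ)

/-- `ℙ^{k-1} × Spec A = Proj A[y_1, …, y_k]`. -/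
def projSpace : Scheme.{u} := Proj (homogeneousSubmodule (Fin k) A)

/-- The projection `ℙ^{k-1} × Spec A → Spec A`. -/
def projSpaceToSpec : projSpace A k ⟶ Spec (CommRingCat.of A) :=
  Proj.toSpecZero (homogeneousSubmodule (Fin k) A) ≫
    Spec.map (CommRingCat.ofHom (algebraMap A (homogeneousSubmodule (Fin k) A 0)))

variable {A k}

/-- The degree zero part of the localization `J[1/y_i]`, an ideal of the coordinate ring
`A[y_1, …, y_k, 1/y_i]_0` of the standard chart `y_i ≠ 0`. -/
def chartIdeal (J : Ideal (MvPolynomial (Fin k) A)) (i : Fin k) :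
    Ideal (HomogeneousLocalization.Away (homogeneousSubmodule (Fin k) A) (X i)) :=
  (J.map (algebraMap (MvPolynomial (Fin k) A)
      (Localization (Submonoid.powers (X i : MvPolynomial (Fin k) A))))).comap
    (algebraMap (HomogeneousLocalization.Away (homogeneousSubmodule (Fin k) A) (X i))
      (Localization (Submonoid.powers (X i : MvPolynomial (Fin k) A))))

/-- The standard chart `y_i ≠ 0` of `ℙ^{k-1} × Spec A`. -/
def chart (i : Fin k) :
    Spec (CommRingCat.of
      (HomogeneousLocalization.Away (homogeneousSubmodule (Fin k) A) (X i))) ⟶ projSpace A k :=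
  Proj.awayι (homogeneousSubmodule (Fin k) A) (X i) (m := 1)
    ((mem_homogeneousSubmodule 1 _).2 (isHomogeneous_X A i)) Nat.one_pos

/-- The ideal sheaf on `ℙ^{k-1} × Spec A` of the closed subscheme `{J = 0}` for a homogeneous ideal
`J` of `A[y_1, …, y_k]`: a function belongs to it if and only if for each `i` its restriction to the
chart `y_i ≠ 0` vanishes modulo `J[1/y_i]_0`. -/
def projIdeal (J : Ideal (MvPolynomial (Fin k) A)) : (projSpace A k).IdealSheafData :=
  ⨅ i : Fin k,
    (Spec.map (CommRingCat.ofHom (Ideal.Quotient.mk (chartIdeal J i))) ≫ chart i).ker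

section Subscheme

variable (J : Ideal (MvPolynomial (Fin k) A))

/-- The closed subscheme `{J = 0} ⊂ ℙ^{k-1} × Spec A` for a homogeneous ideal `J`. -/
def projSubscheme : Scheme.{u} := (projIdeal J).subscheme

/-- The inclusion `{J = 0} ⊂ ℙ^{k-1} × Spec A`. -/
def projSubschemeι : projSubscheme J ⟶ projSpace A k := (projIdeal J).subschemeι

/-- The projection `π : {J = 0} → Spec A`. -/
def projSubschemeToSpec : projSubscheme J ⟶ Spec (CommRingCat.of A) :=
  projSubschemeι J ≫ projSpaceToSpec A k

/-- The critical locus `Crit(π)` of the projection `π : {J = 0} → Spec A`, taken with respect to the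
relative dimension `d`. -/
def crit (d : ℤ) : Scheme.{u} := (criticalIdeal (projSubschemeToSpec J) d).subscheme

/-- The inclusion of `Crit(π)` into `ℙ^{k-1} × Spec A`. -/
def critι (d : ℤ) : crit J d ⟶ projSpace A k :=
  (criticalIdeal (projSubschemeToSpec J) d).subschemeι ≫ projSubschemeι J

/-- The restriction of `π` to `Crit(π)`. -/
def critToSpec (d : ℤ) : crit J d ⟶ Spec (CommRingCat.of A) := critι J d ≫ projSpaceToSpec A k

end Subscheme

/-- The ideal of the `r × r` minors of the matrix `(∂F_a/∂y_b)` of derivatives with respect to the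
homogeneous coordinates. -/
def jacobianMinors {r : ℕ} (F : Fin r → MvPolynomial (Fin k) A) : Ideal (MvPolynomial (Fin k) A) :=
  Ideal.span (Set.range fun c : Fin r → Fin k =>
    Matrix.det (Matrix.of fun a b => pderiv (c b) (F a)))

end Projective

/-! ### The classical discriminant of projective complete intersections -/

section Classical

variable (K : Type v) [Field K] (k : ℕ) {r : ℕ} (p : Fin r → ℕ)

/-- The coefficients of `r`-tuples of forms of degrees `p_1, …, p_r` in `y_1, …, y_k`: pairs of an
index `j` and an exponent `(m_1, …, m_k)` with `m_1 + ⋯ + m_k = p_j`. -/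
abbrev CoeffIndex : Type :=
  Σ j : Fin r, {m : Fin k →₀ ℕ // m ∈ Finset.finsuppAntidiag Finset.univ (p j)}

/-- The `r`-tuple of forms of degrees `p_1, …, p_r` whose coefficients are indeterminates. -/
def universalForm (j : Fin r) : MvPolynomial (Fin k) (MvPolynomial (CoeffIndex k p) K) :=
  ∑ m : {m : Fin k →₀ ℕ // m ∈ Finset.finsuppAntidiag Finset.univ (p j)},
    monomial m.1 (X ⟨j, m⟩)

/-- The ideal of the classical discriminant of complete intersections of codimension `r` and
multidegree `(p_1, …, p_r)` in `ℙ^{k-1}`, in the polynomial ring of the coefficients of the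
equations. -/
def classicalDiscriminant : Ideal (MvPolynomial (CoeffIndex k p) K) :=
  closedFittingImage
    (critToSpec (Ideal.span (Set.range (universalForm K k p))) ((k : ℤ) - 1 - r))

end Classical

/-! ### Leading terms and good bases -/

section Germs

variable {R : Type u} [CommRing R] {k : ℕ} (g : Fin k → R)

/-- The ideal `I_Z = (g_1, …, g_k)`. -/
abbrev centerIdeal : Ideal R := Ideal.span (Set.range g)

/-- The local ring `𝒪_Z = R / I_Z`. -/
abbrev CenterRing : Type u := R ⧸ centerIdeal g

/-- `f` has order `p` along `Z` and its leading term is `F`: there is an expansion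
`f = ∑_{|m| = p} a_m g^m` such that `F = ∑ a_m|_Z y^m`. -/
def IsLeadingForm (p : ℕ) (f : R) (F : MvPolynomial (Fin k) (CenterRing g)) : Prop :=
  f ∉ centerIdeal g ^ (p + 1) ∧
  ∃ H : MvPolynomial (Fin k) R, H.IsHomogeneous p ∧ aeval g H = f ∧
    F = map (Ideal.Quotient.mk (centerIdeal g)) H

/-- The ideal of `gr_{I_Z} R = 𝒪_Z[y_1, …, y_k]` generated by the leading terms of all the elements
of `I_X`. -/
def conormalIdeal (IX : Ideal R) : Ideal (MvPolynomial (Fin k) (CenterRing g)) :=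
  Ideal.span {F | ∃ f ∈ IX, ∃ p, IsLeadingForm g p f F}

/-- `f_1, …, f_r` is a good basis of `I_X`, with multiplicity sequence `p_1 ≤ ⋯ ≤ p_r` and leading
terms `F_1, …, F_r`: both `f` and `F` are regular sequences, `f` generates `I_X` and `F` generates
the conormal ideal.  (So `X` is a strictly complete intersection over `Z`, i.e. the conormal ideal is
generated by a regular sequence.) -/
structure IsGoodBasis (IX : Ideal R) {r : ℕ} (f : Fin r → R) (p : Fin r → ℕ)
    (F : Fin r → MvPolynomial (Fin k) (CenterRing g)) : Prop where
  regular : RingTheory.Sequence.IsRegular R (List.ofFn f)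
  span_eq : Ideal.span (Set.range f) = IX
  monotone : Monotone p
  leading : ∀ j, IsLeadingForm g (p j) (f j) (F j)
  regular_leading :
    RingTheory.Sequence.IsRegular (MvPolynomial (Fin k) (CenterRing g)) (List.ofFn F)
  span_leading : Ideal.span (Set.range F) = conormalIdeal g IX

/-- The ideal of the discriminant of transversal type in `A = 𝒪_Z`, where `F_1, …, F_r` are the
leading terms and `p_1, …, p_r` their degrees: the pullback of the classical discriminant under the
map from `Z` to the space of coefficients given by the coefficients of `F_1, …, F_r`.  (If `D` is an
equation of the classical discriminant, this is the ideal generated by the value of `D` at the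
coefficients of `F_1, …, F_r`.) -/
def transversalDiscriminant (K : Type v) [Field K] {A : Type u} [CommRing A] [Algebra K A]
    {r : ℕ} (p : Fin r → ℕ) (F : Fin r → MvPolynomial (Fin k) A) : Ideal A :=
  (classicalDiscriminant K k p).map
    (aeval fun c : CoeffIndex k p => coeff c.2.1 (F c.1) : MvPolynomial (CoeffIndex k p) K →ₐ[K] A)

end Germs

end TransversalDiscriminant

end

noncomputable section

namespace TransversalDiscriminant

universe u v

attribute [local instance] MvPolynomial.gradedAlgebra

/-! ### Minors of submodules, taken with arbitrary linear forms. -/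

section Fitting

/-! Write A for 𝒪_Z. On the chart L ≠ 0 of a linear form L, a closed subscheme {J = 0} of ℙ^{k-1} ×
Spec A has coordinate ring A[y]/(L - 1, J), because dehomogenization A[y] → A[y, 1/L]_0 is
surjective with kernel (L - 1) (`ker_awayDehom`, `projIdeal_ideal`, `ker_schemeSec`).

Equations of the critical locus. For L = y_i this ring is given by k generators and r + 1 relations,
so Fitt_{k-1-r} of its differentials is generated by the maximal minors of the Jacobian matrix of
(y_i - 1, F_1, …, F_r). Expansion along the row of y_i - 1 puts them into the ideal of r × r minors
of (dF_1, …, dF_r). Conversely, Euler's identity ∑ y_l ∂_l F_j = p_j F_j, which is zero on the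
subscheme, together with ∑ y_l ∂_l (y_i - 1) = y_i = 1, writes each r × r minor as a combination of
the larger ones (`span_minors_cons_eq`). The resulting formula `ker_critι` holds for any family of
forms. Applied also to the universal family over S, it shows that the equations of Crit(π) are those
of Crit(π_S) with the coefficients specialized along S → A.

The discriminant. A is local, so a finite Crit(π) has finitely many points over the closed point. As
K is infinite, some L with coefficients in K vanishes at none of them, and since π is closed,
Crit(π) then misses the whole hyperplane L = 0. Hence π_*𝒪_{Crit(π)} = A[y]/(L - 1, equations). Let
s be the image in S of the closed point. A point of Crit(π_S) over s with L = 0 would produce,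
through a common extension of residue fields, a point of Crit(π) with L = 0
(`mem_preimage_linOpen_of_map`). So over a neighbourhood of s the scheme Crit(π_S) lies in L ≠ 0;
there it is affine and proper over the base, hence finite, and its pushforward is given by S[y]/(L -
1, universal equations). The base change of this module to A is the previous one, and Fitting ideals
commute with base change (`fittingIdeal_baseChange`). It remains to see that schematic closure
changes nothing at s: since S is noetherian, the ideal of the closure localizes at s to the Fitting
ideal of the stalk (`map_iInf_localFitting`). The pieces are joined in `map_closedFittingImage`. -/

/-- A multilinear form with values in an ideal on a set has values in it on the span of the set. -/
theorem multilinearMap_mem_of_mem_span {A P : Type*} {ι : Type*} [CommRing A] [AddCommGroup P]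
    [Module A P] [Fintype ι] [DecidableEq ι] (f : MultilinearMap A (fun _ : ι => P) A) (I : Ideal A)
    (T : Set P) (h : ∀ ρ : ι → P, (∀ i, ρ i ∈ T) → f ρ ∈ I) (ρ : ι → P)
    (hρ : ∀ i, ρ i ∈ Submodule.span A T) : f ρ ∈ I := by
  suffices H : ∀ (s : Finset ι) (ρ : ι → P), (∀ i ∈ s, ρ i ∈ Submodule.span A T) →
      (∀ i ∉ s, ρ i ∈ T) → f ρ ∈ I from
    H Finset.univ ρ (fun i _ => hρ i) (fun i hi => absurd (Finset.mem_univ i) hi)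
  intro s
  induction s using Finset.induction_on with
  | empty => exact fun ρ _ h2 => h ρ fun i => h2 i (Finset.notMem_empty i)
  | insert a s ha ih =>
    intro ρ h1 h2
    suffices H : ∀ x ∈ Submodule.span A T, f (Function.update ρ a x) ∈ I by
      simpa using H (ρ a) (h1 a (Finset.mem_insert_self a s))
    intro x hx
    induction hx using Submodule.span_induction with
    | mem x hx =>
      refine ih _ (fun i hi => ?_) (fun i hi => ?_)
      · have : i ≠ a := fun h => ha (h ▸ hi)
        simpa [this] using h1 i (Finset.mem_insert_of_mem hi)
      · by_cases hia : i = a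
        · subst hia; simpa using hx
        · simpa [hia] using h2 i (by simp [hia, hi])
    | zero => simp
    | add x y _ _ hx hy => rw [f.map_update_add]; exact I.add_mem hx hy
    | smul c x _ hx => rw [f.map_update_smul]; exact I.mul_mem_left c hx

variable {A : Type*} [CommRing A]

/-- The matrices `(ψ_l(ρ_i))` as multilinear functions of their columns. -/
theorem det_mem_of_forms_mem_span {P : Type*} [AddCommGroup P] [Module A P] {q : ℕ} (I : Ideal A)
    (T : Set (P →ₗ[A] A)) (ρ : Fin q → P)
    (h : ∀ ψ : Fin q → P →ₗ[A] A, (∀ l, ψ l ∈ T) →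
      Matrix.det (Matrix.of fun i l => ψ l (ρ i)) ∈ I)
    (ψ : Fin q → P →ₗ[A] A) (hψ : ∀ l, ψ l ∈ Submodule.span A T) :
    Matrix.det (Matrix.of fun i l => ψ l (ρ i)) ∈ I := by
  let ev : (P →ₗ[A] A) →ₗ[A] (Fin q → A) := LinearMap.pi fun i => LinearMap.applyₗ (ρ i)
  have key : ∀ ψ : Fin q → P →ₗ[A] A, Matrix.det (Matrix.of fun i l => ψ l (ρ i)) =
      (Matrix.detRowAlternating.toMultilinearMap.compLinearMap fun _ : Fin q => ev) ψ := by
    intro ψ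
    rw [← Matrix.det_transpose]
    rfl
  rw [key]
  refine multilinearMap_mem_of_mem_span _ I T (fun ψ h' => ?_) ψ hψ
  rw [← key]
  exact h ψ h'

/-- The matrices `(ψ_l(ρ_i))` as multilinear functions of their rows. -/
theorem det_mem_of_vectors_mem_span {P : Type*} [AddCommGroup P] [Module A P] {q : ℕ} (I : Ideal A)
    (T : Set P) (ψ : Fin q → P →ₗ[A] A)
    (h : ∀ ρ : Fin q → P, (∀ l, ρ l ∈ T) → Matrix.det (Matrix.of fun i l => ψ l (ρ i)) ∈ I)
    (ρ : Fin q → P) (hρ : ∀ l, ρ l ∈ Submodule.span A T) :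
    Matrix.det (Matrix.of fun i l => ψ l (ρ i)) ∈ I :=
  multilinearMap_mem_of_mem_span
    (Matrix.detRowAlternating.toMultilinearMap.compLinearMap fun _ : Fin q => LinearMap.pi ψ)
    I T h ρ hρ

/-- The ideal of minors of size `q` of the elements of a submodule. -/
def minorsIdeal {P : Type*} [AddCommGroup P] [Module A P] (N : Submodule A P) (q : ℕ) : Ideal A :=
  Ideal.span {d | ∃ (ρ : Fin q → P) (ψ : Fin q → P →ₗ[A] A), (∀ i, ρ i ∈ N) ∧
    d = Matrix.det (Matrix.of fun i l => ψ l (ρ i))}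

theorem det_mem_minorsIdeal {P : Type*} [AddCommGroup P] [Module A P] (N : Submodule A P) {q : ℕ}
    (ρ : Fin q → P) (ψ : Fin q → P →ₗ[A] A) (hρ : ∀ i, ρ i ∈ N) :
    Matrix.det (Matrix.of fun i l => ψ l (ρ i)) ∈ minorsIdeal N q :=
  Ideal.subset_span ⟨ρ, ψ, hρ, rfl⟩

theorem minorsIdeal_zero {P : Type*} [AddCommGroup P] [Module A P] (N : Submodule A P) :
    minorsIdeal N 0 = ⊤ := by
  rw [Ideal.eq_top_iff_one]
  convert! det_mem_minorsIdeal N (q := 0) Fin.elim0 Fin.elim0 (fun i => i.elim0)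
  simp

theorem minorsIdeal_comap_le {P P' : Type*} [AddCommGroup P] [Module A P] [AddCommGroup P']
    [Module A P'] (e : P →ₗ[A] P')  (N : Submodule A P) (N' : Submodule A P')
    (e' : P' →ₗ[A] P) (hee : ∀ x, e' (e x) = x) (h : ∀ x ∈ N, e x ∈ N') (q : ℕ) :
    minorsIdeal N q ≤ minorsIdeal N' q := by
  refine Ideal.span_le.2 ?_
  rintro _ ⟨ρ, ψ, hρ, rfl⟩
  convert! det_mem_minorsIdeal N' (fun i => e (ρ i)) (fun l => ψ l ∘ₗ e') (fun i => h _ (hρ i))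
  simp [hee]

theorem minorsIdeal_congr {P P' : Type*} [AddCommGroup P] [Module A P] [AddCommGroup P']
    [Module A P'] (e : P ≃ₗ[A] P') (N : Submodule A P) (N' : Submodule A P')
    (h : ∀ x, x ∈ N ↔ e x ∈ N') (q : ℕ) : minorsIdeal N q = minorsIdeal N' q := by
  apply le_antisymm
  · exact minorsIdeal_comap_le e.toLinearMap N N' e.symm.toLinearMap (by simp)
      (fun x hx => (h x).1 hx) q
  · exact minorsIdeal_comap_le e.symm.toLinearMap N' N e.toLinearMap (by simp)
      (fun x hx => by rw [h]; simpa using hx) q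

/-- Minors of a perturbation by a matrix of rank one. -/
theorem det_add_mul_mem {q : ℕ} (I : Ideal A) (m : Fin (q + 1) → Fin (q + 1) → A)
    (b t : Fin (q + 1) → A)
    (h : ∀ i j : Fin (q + 1),
      Matrix.det (Matrix.of fun (a c : Fin q) => m (i.succAbove a) (j.succAbove c)) ∈ I) :
    Matrix.det (Matrix.of fun i l => m i l + t l * b i) ∈ I := by
  -- Bordering: `M'` is `m` with the extra row (1, -t) and the extra column (1, b). Subtracting b_i
  -- times the top row from row i gives `M''`, whose determinant is that of the perturbed matrix.
  -- Expanding det `M'` along its first column and then along a row leaves only q × q minors of `m`.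
  let M' : Matrix (Fin (q + 2)) (Fin (q + 2)) A := Matrix.of fun i l =>
    Fin.cases (Fin.cases 1 (fun l => - t l) l : A) (fun i => (Fin.cases (b i) (fun l => m i l) l : A)) i
  let M'' : Matrix (Fin (q + 2)) (Fin (q + 2)) A := Matrix.of fun i l =>
    Fin.cases (Fin.cases 1 (fun l => - t l) l : A)
      (fun i => (Fin.cases 0 (fun l => m i l + t l * b i) l : A)) i
  have e : M'.det = M''.det := by
    refine Matrix.det_eq_of_forall_row_eq_smul_add_const (Fin.cases 0 b) 0 rfl ?_
    intro i j
    cases i using Fin.cases <;> cases j using Fin.cases <;> simp [M', M'']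
    ring
  have e2 : M''.det = Matrix.det (Matrix.of fun i l => m i l + t l * b i) := by
    rw [Matrix.det_succ_column_zero, Fin.sum_univ_succ]
    simp [M'']
    congr 1
  rw [← e2, ← e, Matrix.det_succ_column_zero]
  refine Ideal.sum_mem _ fun i _ => Ideal.mul_mem_left _ _ ?_
  cases i using Fin.cases with
  | zero =>
    rw [Matrix.det_succ_row_zero]
    refine Ideal.sum_mem _ fun j _ => Ideal.mul_mem_left _ _ ?_
    exact h 0 j
  | succ i =>
    rw [Matrix.det_succ_row_zero]
    refine Ideal.sum_mem _ fun j _ => Ideal.mul_mem_left _ _ ?_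
    convert! h i j using 2
    ext a c
    simp [M', Fin.succ_succAbove_succ]

/-- A form on P × A splits as ψ(x, 0) + a ψ(0, 1), so a minor of the product is a minor of N
perturbed by a matrix of rank one. Conversely, the vector (0, 1) and the second projection border
any minor of N by a unit corner. For q = 0 the truncated subtraction is harmless: both sides are the
unit ideal. -/
theorem minorsIdeal_prod_top {P : Type*} [AddCommGroup P] [Module A P] (N : Submodule A P)
    (q : ℕ) : minorsIdeal (N.prod (⊤ : Submodule A A)) q = minorsIdeal N (q - 1) := by
  cases q with
  | zero => simp [minorsIdeal_zero]
  | succ q =>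
    apply le_antisymm
    · refine Ideal.span_le.2 ?_
      rintro _ ⟨ρ, ψ, hρ, rfl⟩
      have : ∀ i l, ψ l (ρ i) = (ψ l ∘ₗ LinearMap.inl A P A) (ρ i).1 +
          (ψ l (0, 1)) * (ρ i).2 := by
        intro i l
        have : ρ i = ((ρ i).1, 0) + (ρ i).2 • ((0 : P), (1 : A)) := by ext <;> simp
        conv_lhs => rw [this, map_add, map_smul]
        simp [mul_comm]
      simp only [this]
      refine det_add_mul_mem _ _ _ _ fun i j => ?_
      exact det_mem_minorsIdeal N (fun a => (ρ (i.succAbove a)).1)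
        (fun c => ψ (j.succAbove c) ∘ₗ LinearMap.inl A P A) (fun a => (hρ _).1)
    · refine Ideal.span_le.2 ?_
      rintro _ ⟨ρ, ψ, hρ, rfl⟩
      convert! det_mem_minorsIdeal (N.prod (⊤ : Submodule A A)) (q := q + 1)
        (Fin.cons (0, 1) fun i => (ρ i, 0))
        (Fin.cons (LinearMap.snd A P A) fun l => ψ l ∘ₗ LinearMap.fst A P A) (fun i => by
          cases i using Fin.cases <;> simp [Submodule.mem_prod, hρ]) using 1
      rw [Matrix.det_succ_column_zero, Fin.sum_univ_succ]
      simp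
      congr 1

end Fitting

/-! ### Fitting ideals: independence of the presentation and base change. -/

section FittingPresentation

variable {A : Type*} [CommRing A]

theorem minorsIdeal_prod_top_pi {P : Type*} [AddCommGroup P] [Module A P] (N : Submodule A P)
    (n q : ℕ) :
    minorsIdeal (N.prod (⊤ : Submodule A (Fin n → A))) q = minorsIdeal N (q - n) := by
  induction n generalizing q with
  | zero =>
    exact (minorsIdeal_congr ((LinearEquiv.prodUnique (R := A) (M := P) (M₂ := Fin 0 → A)).symm)
      N _ (fun x => by simp) q).symm
  | succ n ih =>
    rw [show q - (n + 1) = q - 1 - n by omega, ← ih, ← minorsIdeal_prod_top]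
    let e : (P × (Fin (n + 1) → A)) ≃ₗ[A] ((P × (Fin n → A)) × A) :=
      ((LinearEquiv.refl A P).prodCongr
        ((Fin.consLinearEquiv A (fun _ : Fin (n + 1) => A)).symm.trans
          (LinearEquiv.prodComm A _ _))).trans (LinearEquiv.prodAssoc A _ _ _).symm
    refine minorsIdeal_congr e (N.prod ⊤) ((N.prod ⊤).prod ⊤) (fun x => ?_) q
    simp [e, Submodule.mem_prod]
    rfl

/-- Superfluous generators only shift the size of the minors: lifting π' through π to a map s, the
shear (x, v) ↦ (x + s v, v) carries the relations of the enlarged family to ker π × (everything). -/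
theorem minorsIdeal_ker_coprod {P M : Type*} [AddCommGroup P] [Module A P] [AddCommGroup M]
    [Module A M] (π : P →ₗ[A] M) (hπ : Function.Surjective π) {n : ℕ} (π' : (Fin n → A) →ₗ[A] M)
    (q : ℕ) : minorsIdeal (LinearMap.ker (π.coprod π')) q = minorsIdeal (LinearMap.ker π) (q - n) := by
  obtain ⟨s, hs⟩ := Module.projective_lifting_property π π' hπ
  rw [← minorsIdeal_prod_top_pi]
  let e : (P × (Fin n → A)) ≃ₗ[A] (P × (Fin n → A)) :=
    (LinearEquiv.prodComm A _ _).trans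
      ((LinearEquiv.skewProd (LinearEquiv.refl A _) (LinearEquiv.refl A _) s).trans
        (LinearEquiv.prodComm A _ _))
  refine minorsIdeal_congr e _ _ (fun x => ?_) q
  simp [e, Submodule.mem_prod, ← hs]

/-- Both presentations are compared with their union on n + n' generators. The truncations in
`toNat` agree with those of the natural subtraction, so negative sizes cause no exception. -/
theorem minorsIdeal_ker_eq {M : Type*} [AddCommGroup M] [Module A M] {n n' : ℕ}
    (π : (Fin n → A) →ₗ[A] M) (hπ : Function.Surjective π)
    (π' : (Fin n' → A) →ₗ[A] M) (hπ' : Function.Surjective π') (j : ℤ) :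
    minorsIdeal (LinearMap.ker π) ((n : ℤ) - j).toNat =
      minorsIdeal (LinearMap.ker π') ((n' : ℤ) - j).toNat := by
  have h1 : ((n : ℤ) - j).toNat = ((n : ℤ) + n' - j).toNat - n' := by omega
  have h2 : ((n' : ℤ) - j).toNat = ((n : ℤ) + n' - j).toNat - n := by omega
  rw [h1, h2, ← minorsIdeal_ker_coprod π hπ π', ← minorsIdeal_ker_coprod π' hπ' π]
  refine minorsIdeal_congr (LinearEquiv.prodComm A _ _) _ _ (fun x => ?_) _
  simp [add_comm]

theorem forms_mem_span_proj {n : ℕ} (ψ : (Fin n → A) →ₗ[A] A) :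
    ψ ∈ Submodule.span A (Set.range fun l : Fin n => (LinearMap.proj l : (Fin n → A) →ₗ[A] A)) := by
  have : ψ = ∑ l, ψ (Pi.single l 1) • (LinearMap.proj l : (Fin n → A) →ₗ[A] A) := by
    refine LinearMap.pi_ext' fun l => LinearMap.ext_ring ?_
    simp [Pi.single_apply]
  rw [this]
  exact Submodule.sum_mem _ fun l _ => Submodule.smul_mem _ _ (Submodule.subset_span ⟨l, rfl⟩)

theorem surjective_linearCombination {M : Type*} [AddCommGroup M] [Module A M] {n : ℕ}
    {x : Fin n → M} (hx : Submodule.span A (Set.range x) = ⊤) :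
    Function.Surjective (Fintype.linearCombination A x) := by
  rw [← LinearMap.range_eq_top, Fintype.range_linearCombination, hx]

/-- It is enough to consider vectors of a generating set and coordinate functions. -/
theorem minorsIdeal_span_le {n : ℕ} (I : Ideal A) (T : Set (Fin n → A)) (q : ℕ)
    (h : ∀ (ρ : Fin q → Fin n → A) (c : Fin q → Fin n), (∀ i, ρ i ∈ T) →
      Matrix.det (Matrix.of fun i l => ρ i (c l)) ∈ I) :
    minorsIdeal (Submodule.span A T) q ≤ I := by
  refine Ideal.span_le.2 ?_
  rintro _ ⟨ρ, ψ, hρ, rfl⟩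
  refine det_mem_of_vectors_mem_span I T ψ (fun ρ hρ => ?_) ρ hρ
  refine det_mem_of_forms_mem_span I _ ρ (fun ψ hψ => ?_) ψ fun l => forms_mem_span_proj _
  choose c hc using hψ
  simp only [← hc]
  exact h ρ c hρ

/-- The definition collects minors from all finite generating families. By independence of the
presentation every family contributes to the same ideal, so one family suffices. -/
theorem fittingIdeal_eq_minorsIdeal {A : Type u} [CommRing A] {M : Type v} [AddCommGroup M]
    [Module A M] {n : ℕ} (x : Fin n → M)
    (hx : Submodule.span A (Set.range x) = ⊤) (j : ℤ) :
    fittingIdeal A M j =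
      minorsIdeal (LinearMap.ker (Fintype.linearCombination A x)) ((n : ℤ) - j).toNat := by
  apply le_antisymm
  · refine Ideal.span_le.2 ?_
    rintro _ ⟨n', x', hx', ρ, c, hρ, rfl⟩
    rw [minorsIdeal_ker_eq _ (surjective_linearCombination hx) _ (surjective_linearCombination hx')]
    exact det_mem_minorsIdeal _ ρ (fun l => LinearMap.proj (c l)) (fun i => by
      simpa [Fintype.linearCombination_apply] using hρ i)
  · rw [← Submodule.span_eq (LinearMap.ker (Fintype.linearCombination A x))]
    refine minorsIdeal_span_le _ _ _ fun ρ c hρ => Ideal.subset_span ?_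
    exact ⟨n, x, hx, ρ, c, fun i => by simpa [Fintype.linearCombination_apply] using hρ i, rfl⟩

/-- The Fitting ideal of a module with `n` generators and `m` relations whose index is `n - m`. -/
theorem fittingIdeal_eq_span_minors {A : Type u} [CommRing A] {M : Type v} [AddCommGroup M]
    [Module A M] {n m : ℕ} (x : Fin n → M) (hx : Submodule.span A (Set.range x) = ⊤)
    (ρ : Fin m → Fin n → A)
    (hρ : LinearMap.ker (Fintype.linearCombination A x) = Submodule.span A (Set.range ρ)) :
    fittingIdeal A M ((n : ℤ) - m) =
      Ideal.span (Set.range fun c : Fin m → Fin n =>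
        Matrix.det (Matrix.of fun a b => ρ a (c b))) := by
  rw [fittingIdeal_eq_minorsIdeal x hx, show ((n : ℤ) - ((n : ℤ) - m)).toNat = m by omega, hρ]
  apply le_antisymm
  · refine minorsIdeal_span_le _ _ _ fun ρ' c hρ' => ?_
    choose s hs using hρ'
    -- Rows picked from the m given relations, possibly with repetition, form a selection matrix
    -- times the full minor.
    have : (Matrix.of fun i l => ρ' i (c l)) =
        (1 : Matrix (Fin m) (Fin m) A).submatrix s id * (Matrix.of fun a b => ρ a (c b)) := by
      ext i l
      simp [Matrix.mul_apply, ← hs, Matrix.one_apply]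
    rw [this, Matrix.det_mul]
    exact Ideal.mul_mem_left _ _ (Ideal.subset_span ⟨c, rfl⟩)
  · refine Ideal.span_le.2 ?_
    rintro _ ⟨c, rfl⟩
    exact det_mem_minorsIdeal _ ρ (fun l => LinearMap.proj (c l))
      fun i => Submodule.subset_span ⟨i, rfl⟩

/-- Fitting ideals commute with base change. -/
theorem fittingIdeal_baseChange {A B M M' : Type*} [CommRing A] [CommRing B] [Algebra A B]
    [AddCommGroup M] [Module A M] [AddCommGroup M'] [Module A M'] [Module B M']
    [IsScalarTower A B M'] [Module.Finite A M] (f : M →ₗ[A] M') (hf : IsBaseChange B f) (j : ℤ) :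
    fittingIdeal B M' j = (fittingIdeal A M j).map (algebraMap A B) := by
  obtain ⟨n, x, hx⟩ := Module.Finite.exists_fin (R := A) (M := M)
  have hx' : Submodule.span B (Set.range (f ∘ x)) = ⊤ := by
    rw [eq_top_iff]
    rintro m -
    induction m using hf.inductionOn with
    | zero => exact zero_mem _
    | tmul m =>
      have hm : m ∈ Submodule.span A (Set.range x) := hx ▸ Submodule.mem_top
      induction hm using Submodule.span_induction with
      | mem _ h => obtain ⟨i, rfl⟩ := h; exact Submodule.subset_span ⟨i, rfl⟩
      | zero => simp
      | add _ _ _ _ h h' => rw [map_add]; exact add_mem h h'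
      | smul a _ _ h => rw [map_smul, algebra_compatible_smul B]; exact Submodule.smul_mem _ _ h
    | smul b m h => exact Submodule.smul_mem _ _ h
    | add _ _ h h' => exact add_mem h h'
  let ι : (Fin n → A) →ₗ[A] (Fin n → B) := LinearMap.pi fun i =>
    (Algebra.linearMap A B) ∘ₗ LinearMap.proj i
  let π := Fintype.linearCombination A x
  let N := Submodule.span B (ι '' LinearMap.ker π)
  have hker : LinearMap.ker (Fintype.linearCombination B (f ∘ x)) = N := by
    apply le_antisymm
    -- Right exactness by hand: x_i ↦ class of the i-th basis vector is a well-defined map from M to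
    -- B^n / N. Its extension to M' sends ∑ b_i f(x_i) to the class of b, so every relation b over B
    -- lies in N.
    · let e := π.quotKerEquivOfSurjective (surjective_linearCombination hx)
      let g : M →ₗ[A] ((Fin n → B) ⧸ N) :=
        ((LinearMap.ker π).liftQ ((N.mkQ.restrictScalars A) ∘ₗ ι) (fun a ha => by
          simpa using Submodule.subset_span (Set.mem_image_of_mem _ ha))) ∘ₗ e.symm.toLinearMap
      have hg : ∀ v, g (π v) = N.mkQ (ι v) := by
        intro v
        have : e.symm (π v) = (LinearMap.ker π).mkQ v := by
          rw [LinearEquiv.symm_apply_eq]; rfl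
        simp [g, this]
      intro b hb
      have h2 : ∀ i, N.mkQ (Pi.single i 1) = hf.lift g (f (x i)) := by
        intro i
        rw [hf.lift_eq]
        have : x i = π (Pi.single i 1) := by simp [π]
        rw [this, hg]
        congr 1
        ext l
        by_cases h : i = l
        · subst h; simp [ι]
        · simp [ι, Ne.symm h]
      have h3 : N.mkQ b = hf.lift g (Fintype.linearCombination B (f ∘ x) b) := by
        rw [Fintype.linearCombination_apply, map_sum]
        conv_lhs => rw [pi_eq_sum_univ' b, map_sum]
        refine Finset.sum_congr rfl fun i _ => ?_
        rw [map_smul, map_smul, Function.comp, ← h2]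
      rw [LinearMap.mem_ker.1 hb, map_zero] at h3
      simpa using h3
    · refine Submodule.span_le.2 ?_
      rintro _ ⟨a, ha, rfl⟩
      have h : ∑ i, a i • x i = 0 := by simpa [π, Fintype.linearCombination_apply] using ha
      have := congrArg f h
      rw [map_sum, map_zero] at this
      simpa [Fintype.linearCombination_apply, ι] using this
  rw [fittingIdeal_eq_minorsIdeal _ hx', fittingIdeal_eq_minorsIdeal _ hx, hker]
  apply le_antisymm
  · refine minorsIdeal_span_le _ _ _ fun ρ c hρ => ?_
    choose s hs hs' using hρ
    have : (Matrix.of fun i l => ρ i (c l)) =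
        (algebraMap A B).mapMatrix (Matrix.of fun i l => s i (c l)) := by
      ext i l
      simp [← hs', ι]
    rw [this, ← RingHom.map_det]
    exact Ideal.mem_map_of_mem _ (det_mem_minorsIdeal _ s (fun l => LinearMap.proj (c l)) hs)
  · rw [Ideal.map_le_iff_le_comap, ← Submodule.span_eq (LinearMap.ker _)]
    refine minorsIdeal_span_le _ _ _ fun ρ c hρ => ?_
    rw [Ideal.mem_comap, RingHom.map_det]
    exact det_mem_minorsIdeal _ (fun i => ι (ρ i)) (fun l => LinearMap.proj (c l))
      fun i => Submodule.subset_span ⟨_, hρ i, rfl⟩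

end FittingPresentation

/-! ### Dehomogenization with respect to an arbitrary linear form. -/

section Dehomogenization

theorem X_mem_one {A : Type u} [CommRing A] {k : ℕ} (i : Fin k) :
    (X i : MvPolynomial (Fin k) A) ∈ homogeneousSubmodule (Fin k) A 1 :=
  isHomogeneous_X A i

open HomogeneousLocalization

variable {A : Type u} [CommRing A] {k : ℕ}

/-- Dehomogenization with respect to a linear form `L`: the map `A[y] → A[y, 1/L]_0` which sends
`y_j` to `y_j / L`. -/
def awayDehom (L : MvPolynomial (Fin k) A) (hL : L ∈ homogeneousSubmodule (Fin k) A 1) :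
    MvPolynomial (Fin k) A →+* Away (homogeneousSubmodule (Fin k) A) L :=
  eval₂Hom ((fromZeroRingHom (homogeneousSubmodule (Fin k) A) (Submonoid.powers L)).comp
    (algebraMap A (homogeneousSubmodule (Fin k) A 0)))
    fun j => Away.mk _ hL 1 (X j) (X_mem_one j)

variable {L : MvPolynomial (Fin k) A} (hL : L ∈ homogeneousSubmodule (Fin k) A 1)

/-- Each monomial of degree n acquires exactly the denominator L^n. Most later facts on
dehomogenization are deduced from this identity in the full localization, where L is a unit. -/
theorem val_awayDehom_mul {n : ℕ} {b : MvPolynomial (Fin k) A}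
    (hb : b ∈ homogeneousSubmodule (Fin k) A n) :
    (awayDehom L hL b).val * algebraMap _ (Localization.Away L) (L ^ n) =
      algebraMap _ (Localization.Away L) b := by
  have key : ∀ p : MvPolynomial (Fin k) A, (awayDehom L hL p).val =
      eval₂ ((algebraMap (MvPolynomial (Fin k) A) (Localization.Away L)).comp C)
        (fun j => Localization.mk (X j) ⟨L ^ 1, 1, rfl⟩) p := by
    intro p
    induction p using MvPolynomial.induction_on with
    | C a =>
      simp [awayDehom]
      rfl
    | add p q hp hq => rw [map_add, val_add, hp, hq, eval₂_add]
    | mul_X p j hp =>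
      rw [map_mul, val_mul, hp, eval₂_mul, eval₂_X]
      congr 1
      simp only [awayDehom, coe_eval₂Hom, eval₂_X]
      rfl
  have h2 : algebraMap _ (Localization.Away L) b =
      eval₂ ((algebraMap (MvPolynomial (Fin k) A) (Localization.Away L)).comp C)
        (fun j => algebraMap (MvPolynomial (Fin k) A) (Localization.Away L) (X j)) b := by
    have := eval₂_comp_left (algebraMap (MvPolynomial (Fin k) A) (Localization.Away L)) C X b
    rwa [eval₂_eta] at this
  rw [key, h2, eval₂_eq', eval₂_eq', Finset.sum_mul]
  refine Finset.sum_congr rfl fun m hm => ?_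
  have hd : n = ∑ j, m j := by
    have := hb (mem_support_iff.1 hm)
    rw [← this, Finsupp.weight_apply, Finsupp.sum_fintype] <;> simp
  rw [mul_assoc, hd, ← Finset.prod_pow_eq_pow_sum, map_prod, ← Finset.prod_mul_distrib]
  congr 1
  refine Finset.prod_congr rfl fun j _ => ?_
  rw [map_pow, ← mul_pow, Localization.mk_eq_mk']
  congr 1
  simp

theorem awayDehom_eq_mk {n : ℕ} {b : MvPolynomial (Fin k) A}
    (hb : b ∈ homogeneousSubmodule (Fin k) A (n • 1)) :
    awayDehom L hL b = Away.mk _ hL n b hb := by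
  apply val_injective
  rw [Away.val_mk, Localization.mk_eq_mk', IsLocalization.eq_mk'_iff_mul_eq]
  exact val_awayDehom_mul hL (by simpa using hb)

theorem awayDehom_self : awayDehom L hL L = 1 := by
  apply val_injective
  have h := val_awayDehom_mul hL hL
  have hu : IsUnit (algebraMap _ (Localization.Away L) L) :=
    IsLocalization.Away.algebraMap_isUnit L
  rw [pow_one] at h
  rw [val_one]
  exact hu.mul_right_cancel (by rw [h, one_mul])

theorem awayDehom_surjective_of_homogeneous (z : Away (homogeneousSubmodule (Fin k) A) L) :
    ∃ (n : ℕ) (b : MvPolynomial (Fin k) A), b ∈ homogeneousSubmodule (Fin k) A n ∧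
      awayDehom L hL b = z := by
  obtain ⟨n, b, hb, rfl⟩ := Away.mk_surjective _ hL z
  exact ⟨n, b, by simpa using hb, awayDehom_eq_mk hL hb⟩

theorem awayDehom_surjective : Function.Surjective (awayDehom L hL) := fun z => by
  obtain ⟨n, b, -, h⟩ := awayDehom_surjective_of_homogeneous hL z
  exact ⟨b, h⟩

theorem awayDehom_eq_zero_iff {n : ℕ} {b : MvPolynomial (Fin k) A}
    (hb : b ∈ homogeneousSubmodule (Fin k) A n) :
    awayDehom L hL b = 0 ↔ ∃ t : ℕ, L ^ t * b = 0 := by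
  have h := val_awayDehom_mul hL hb
  constructor
  · intro h0
    rw [h0, val_zero, zero_mul] at h
    obtain ⟨⟨_, t, rfl⟩, ht⟩ := (IsLocalization.map_eq_zero_iff (Submonoid.powers L) _ b).1 h.symm
    exact ⟨t, ht⟩
  · rintro ⟨t, ht⟩
    have := congrArg (awayDehom L hL) ht
    simpa [awayDehom_self] using this

/-- The homogenization of `p` in degree `N` by means of the linear form `L`. -/
theorem exists_homogeneous_sub_mem (L : MvPolynomial (Fin k) A)
    (hL : L ∈ homogeneousSubmodule (Fin k) A 1) (p : MvPolynomial (Fin k) A) :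
    ∃ (n : ℕ) (b : MvPolynomial (Fin k) A), b ∈ homogeneousSubmodule (Fin k) A n ∧
      p - b ∈ Ideal.span {L - 1} := by
  have hpow : ∀ m : ℕ, L ^ m - 1 ∈ Ideal.span {L - 1} := fun m =>
    Ideal.mem_span_singleton.2 (sub_one_dvd_pow_sub_one L m)
  refine ⟨p.totalDegree, ∑ i ∈ Finset.range (p.totalDegree + 1),
    L ^ (p.totalDegree - i) * homogeneousComponent i p, ?_, ?_⟩
  · refine Submodule.sum_mem _ fun i hi => ?_
    have := IsHomogeneous.mul (IsHomogeneous.pow hL (p.totalDegree - i))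
      (homogeneousComponent_isHomogeneous i p)
    have e : 1 * (p.totalDegree - i) + i = p.totalDegree := by
      have := Finset.mem_range.1 hi; omega
    rw [e] at this
    exact this
  · nth_rewrite 1 [← sum_homogeneousComponent p]
    rw [← Finset.sum_sub_distrib]
    refine Ideal.sum_mem _ fun i _ => ?_
    have : homogeneousComponent i p - L ^ (p.totalDegree - i) * homogeneousComponent i p =
      - (homogeneousComponent i p * (L ^ (p.totalDegree - i) - 1)) := by ring
    rw [this]
    exact neg_mem (Ideal.mul_mem_left _ _ (hpow _))

/-- Modulo L - 1 every polynomial is congruent to a homogeneous b. If b/L^n = 0, then L^t b = 0 for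
some t, and L^t ≡ 1 forces b into (L - 1). The form L may be a zero divisor. -/
theorem ker_awayDehom : RingHom.ker (awayDehom L hL) = Ideal.span {L - 1} := by
  apply le_antisymm
  · intro p hp
    obtain ⟨n, b, hb, hpb⟩ := exists_homogeneous_sub_mem L hL p
    have hle : Ideal.span {L - 1} ≤ RingHom.ker (awayDehom L hL) := by
      rw [Ideal.span_singleton_le_iff_mem, RingHom.mem_ker, map_sub, awayDehom_self, map_one,
        sub_self]
    have h0 : awayDehom L hL b = 0 := by
      have := (RingHom.ker (awayDehom L hL)).sub_mem hp (hle hpb)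
      simpa using this
    obtain ⟨t, ht⟩ := (awayDehom_eq_zero_iff hL hb).1 h0
    have h1 : L ^ t - 1 ∈ Ideal.span {L - 1} :=
      Ideal.mem_span_singleton.2 (sub_one_dvd_pow_sub_one L t)
    have : p = (p - b) - (L ^ t - 1) * b := by rw [sub_mul, ht]; ring
    rw [this]
    exact sub_mem hpb (Ideal.mul_mem_right _ _ h1)
  · rw [Ideal.span_singleton_le_iff_mem, RingHom.mem_ker, map_sub, awayDehom_self, map_one,
      sub_self]

/-- A homogeneous ideal is generated by homogeneous elements. -/
theorem map_le_of_homogeneous {J : Ideal (MvPolynomial (Fin k) A)}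
    (hJ : J.IsHomogeneous (homogeneousSubmodule (Fin k) A)) {T : Type*} [CommRing T]
    (f : MvPolynomial (Fin k) A →+* T) (I : Ideal T)
    (h : ∀ (n : ℕ), ∀ b ∈ J, b ∈ homogeneousSubmodule (Fin k) A n → f b ∈ I) : J.map f ≤ I := by
  rw [Ideal.map_le_iff_le_comap]
  intro b hb
  classical
  rw [← DirectSum.sum_support_decompose (homogeneousSubmodule (Fin k) A) b]
  exact Ideal.sum_mem _ fun i _ => h i _ (hJ i hb) (SetLike.coe_mem _)

theorem chartIdeal_eq_map {J : Ideal (MvPolynomial (Fin k) A)}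
    (hJ : J.IsHomogeneous (homogeneousSubmodule (Fin k) A)) (i : Fin k) :
    chartIdeal J i = J.map (awayDehom (X i) (X_mem_one i)) := by
  apply le_antisymm
  · intro z hz
    obtain ⟨n, b, hb, rfl⟩ := awayDehom_surjective_of_homogeneous (X_mem_one i) z
    have h := val_awayDehom_mul (X_mem_one i) hb
    have hz' : (awayDehom (X i) (X_mem_one i) b).val ∈ J.map (algebraMap _
      (Localization (Submonoid.powers (X i : MvPolynomial (Fin k) A)))) := hz
    have h1 := Ideal.mul_mem_right
      (algebraMap _ (Localization.Away (X i : MvPolynomial (Fin k) A))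
        ((X i : MvPolynomial (Fin k) A) ^ n)) (Ideal.map _ J) hz'
    rw [h] at h1
    obtain ⟨_, ⟨t, rfl⟩, ht⟩ := (IsLocalization.algebraMap_mem_map_algebraMap_iff
      (Submonoid.powers (X i : MvPolynomial (Fin k) A)) (Localization.Away (X i)) J b).1 h1
    have := Ideal.mem_map_of_mem (awayDehom (X i) (X_mem_one i)) ht
    rwa [map_mul, map_pow, awayDehom_self (X_mem_one i), one_pow, one_mul] at this
  · refine map_le_of_homogeneous hJ _ _ fun n b hb hbn => ?_
    change (awayDehom (X i) (X_mem_one i) b).val ∈ J.map (algebraMap _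
      (Localization (Submonoid.powers (X i : MvPolynomial (Fin k) A))))
    have h := val_awayDehom_mul (X_mem_one i) hbn
    have hu : IsUnit (algebraMap _ (Localization.Away (X i : MvPolynomial (Fin k) A))
        ((X i : MvPolynomial (Fin k) A) ^ n)) := by
      rw [map_pow]; exact (IsLocalization.Away.algebraMap_isUnit _).pow n
    rw [← Ideal.mul_unit_mem_iff_mem _ hu, h]
    exact Ideal.mem_map_of_mem _ hb

variable {L' : MvPolynomial (Fin k) A} (hL' : L' ∈ homogeneousSubmodule (Fin k) A 1)

theorem val_awayMap_awayDehom_mul {M x : MvPolynomial (Fin k) A} {m : ℕ}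
    (hM : M ∈ homogeneousSubmodule (Fin k) A m) (hx : x = L * M)
    {n : ℕ} {b : MvPolynomial (Fin k) A} (hb : b ∈ homogeneousSubmodule (Fin k) A n) :
    (awayMap _ hM hx (awayDehom L hL b)).val * algebraMap _ (Localization.Away x) L ^ n =
      algebraMap _ (Localization.Away x) b := by
  rw [val_awayMap]
  have h := val_awayDehom_mul hL hb
  have h2 := congrArg (Localization.awayLift (algebraMap _ (Localization.Away x)) L
    (isUnit_of_dvd_unit (map_dvd _ (hx ▸ dvd_mul_right L M))
      (IsLocalization.Away.algebraMap_isUnit x))) h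
  rw [map_mul] at h2
  simpa [Localization.awayLift] using h2

/-- The transition rule b/L^n = (L'/L)^n · b/L'^n on the overlap of two charts. -/
theorem awayMap_awayDehom {n : ℕ} {b : MvPolynomial (Fin k) A}
    (hb : b ∈ homogeneousSubmodule (Fin k) A n) :
    awayMap _ hL' rfl (awayDehom L hL b) =
      awayMap _ hL' rfl (awayDehom L hL L') ^ n *
        awayMap _ hL (mul_comm L L') (awayDehom L' hL' b) := by
  apply val_injective
  have h1 := val_awayMap_awayDehom_mul hL hL' rfl hb
  have h2 := val_awayMap_awayDehom_mul hL hL' rfl hL'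
  have h3 := val_awayMap_awayDehom_mul hL' hL (mul_comm L L') hb
  have hu : IsUnit (algebraMap _ (Localization.Away (L * L')) L) :=
    isUnit_of_dvd_unit (map_dvd _ (dvd_mul_right L L')) (IsLocalization.Away.algebraMap_isUnit _)
  refine (hu.pow n).mul_right_cancel ?_
  rw [h1, val_mul, val_pow]
  rw [pow_one] at h2
  rw [mul_right_comm, ← mul_pow, h2,
    mul_comm (algebraMap _ (Localization.Away (L * L')) L' ^ n)]
  exact h3.symm

end Dehomogenization

/-! ### Affine charts L ≠ 0 of the projective space and their functions. -/

section ProjectiveCharts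

theorem awayToSection_awayι_appLE {σ : Type*} {B : Type u} [CommRing B] [SetLike σ B]
    [AddSubgroupClass σ B] (𝒜 : ℕ → σ) [GradedRing 𝒜] (f : B) {m : ℕ} (hf : f ∈ 𝒜 m) (hm : 0 < m)
    (h : ⊤ ≤ Proj.awayι 𝒜 f hf hm ⁻¹ᵁ Proj.basicOpen 𝒜 f) :
    Proj.awayToSection 𝒜 f ≫ (Proj.awayι 𝒜 f hf hm).appLE (Proj.basicOpen 𝒜 f) ⊤ h =
      (Scheme.ΓSpecIso _).inv := by
  have h0 := Proj.basicOpenToSpec_app_top 𝒜 f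
  have h1 : (Proj.basicOpenIsoSpec 𝒜 f hf hm).hom ≫ Proj.awayι 𝒜 f hf hm = (Proj.basicOpen 𝒜 f).ι := by
    rw [← Proj.basicOpenIsoSpec_inv_ι, Iso.hom_inv_id_assoc]
  have h2 := Scheme.Hom.appLE_comp_appLE (Proj.basicOpenIsoSpec 𝒜 f hf hm).hom
    (Proj.awayι 𝒜 f hf hm) (Proj.basicOpen 𝒜 f) ⊤ ⊤ h le_rfl
  have h0' : (Proj.basicOpenIsoSpec 𝒜 f hf hm).hom.appLE ⊤ ⊤ le_rfl = _ :=
    (Scheme.Hom.appLE_eq_app _).trans h0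
  rw [h0'] at h2
  simp only [h1] at h2
  have h3 : (Proj.basicOpen 𝒜 f).ι.appLE (Proj.basicOpen 𝒜 f) ⊤
      (h1 ▸ fun x hx => h trivial) = (Proj.basicOpen 𝒜 f).topIso.inv := by
    rw [Scheme.Opens.ι_appLE]
    rfl
  rw [h3] at h2
  have : IsIso (Proj.awayToSection 𝒜 f) := by
    rw [← Proj.basicOpenIsoAway_hom 𝒜 f hf hm]; infer_instance
  rw [← cancel_mono ((Scheme.ΓSpecIso _).hom ≫ Proj.awayToSection 𝒜 f ≫ (Proj.basicOpen 𝒜 f).topIso.inv),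
    Category.assoc, h2]
  simp

theorem isIso_awayToSection {σ : Type*} {B : Type u} [CommRing B] [SetLike σ B]
    [AddSubgroupClass σ B] (𝒜 : ℕ → σ) [GradedRing 𝒜] (f : B) {m : ℕ} (hf : f ∈ 𝒜 m) (hm : 0 < m) :
    IsIso (Proj.awayToSection 𝒜 f) := by
  rw [← Proj.basicOpenIsoAway_hom 𝒜 f hf hm]; infer_instance

variable {A : Type u} [CommRing A] {k : ℕ}

instance finiteType_homogeneousSubmodule_zero :
    Algebra.FiniteType (homogeneousSubmodule (Fin k) A 0) (MvPolynomial (Fin k) A) :=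
  haveI : IsScalarTower A (homogeneousSubmodule (Fin k) A 0) (MvPolynomial (Fin k) A) :=
    IsScalarTower.of_algebraMap_eq (R := A) (S := homogeneousSubmodule (Fin k) A 0)
      (A := MvPolynomial (Fin k) A) fun _ => rfl
  Algebra.FiniteType.of_restrictScalars_finiteType A _ _
theorem algebraMap_homogeneousSubmodule_zero_surjective :
   Function.Surjective (algebraMap A (homogeneousSubmodule (Fin k) A 0)) := by
  rintro ⟨x, hx⟩
  refine ⟨coeff 0 x, Subtype.ext ?_⟩
  have : x.totalDegree = 0 := by
    exact Nat.le_zero.1 (IsHomogeneous.totalDegree_le hx)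
  exact (totalDegree_eq_zero_iff_eq_C.1 this).symm

instance : IsClosedImmersion (Spec.map (CommRingCat.ofHom (algebraMap A (homogeneousSubmodule (Fin k) A 0)))) :=
  IsClosedImmersion.spec_of_surjective _ algebraMap_homogeneousSubmodule_zero_surjective

instance : IsProper (projSpaceToSpec A k) := by unfold projSpaceToSpec projSpace; infer_instance
instance : (projSpace A k).IsSeparated := by unfold projSpace; infer_instance

instance : CompactSpace (projSpace A k) :=
  QuasiCompact.compactSpace_of_compactSpace (projSpaceToSpec A k)

/-- The affine open set `L ≠ 0` for a linear form `L`. -/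
def linOpen (L : MvPolynomial (Fin k) A) (hL : L ∈ homogeneousSubmodule (Fin k) A 1) :
    (projSpace A k).affineOpens :=
  ⟨Proj.basicOpen (homogeneousSubmodule (Fin k) A) L, Proj.isAffineOpen_basicOpen _ L hL one_pos⟩

/-- The identification of `A[y, 1/L]_0` with the functions on the set `L ≠ 0`. -/
def awaySec (L : MvPolynomial (Fin k) A) (hL : L ∈ homogeneousSubmodule (Fin k) A 1) :
    HomogeneousLocalization.Away (homogeneousSubmodule (Fin k) A) L →+*
      Γ(projSpace A k, (linOpen L hL).1) :=
  (Proj.awayToSection (homogeneousSubmodule (Fin k) A) L).hom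

/-- Dehomogenization with values in the functions on the set `L ≠ 0`. -/
def linSec (L : MvPolynomial (Fin k) A) (hL : L ∈ homogeneousSubmodule (Fin k) A 1) :
    MvPolynomial (Fin k) A →+* Γ(projSpace A k, (linOpen L hL).1) :=
  (awaySec L hL).comp (awayDehom L hL)

theorem bijective_awaySec {L : MvPolynomial (Fin k) A}
    (hL : L ∈ homogeneousSubmodule (Fin k) A 1) :
    Function.Bijective (awaySec L hL) :=
  have := isIso_awayToSection _ L hL one_pos
  ConcreteCategory.bijective_of_isIso (Proj.awayToSection (homogeneousSubmodule (Fin k) A) L)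

theorem linSec_surjective {L : MvPolynomial (Fin k) A}
    (hL : L ∈ homogeneousSubmodule (Fin k) A 1) : Function.Surjective (linSec L hL) :=
  (bijective_awaySec hL).2.comp (awayDehom_surjective hL)

theorem ker_linSec {L : MvPolynomial (Fin k) A} (hL : L ∈ homogeneousSubmodule (Fin k) A 1) :
    RingHom.ker (linSec L hL) = Ideal.span {L - 1} := by
  rw [← ker_awayDehom hL]
  ext x
  exact map_eq_zero_iff _ (bijective_awaySec hL).1

theorem iSup_linOpen_X : ⨆ i : Fin k, (linOpen (X i : MvPolynomial (Fin k) A)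
    (X_mem_one i)).1 = ⊤ := by
  refine Proj.iSup_basicOpen_eq_top' (homogeneousSubmodule (Fin k) A) (fun i => X i)
    (fun i => ⟨1, X_mem_one i⟩) ?_
  rw [eq_top_iff]
  intro p _
  have hp : p ∈ Algebra.adjoin A (Set.range fun i => (X i : MvPolynomial (Fin k) A)) := by
    rw [adjoin_range_X]; trivial
  induction hp using Algebra.adjoin_induction with
  | mem x hx => exact Algebra.subset_adjoin hx
  | algebraMap a =>
    exact Subalgebra.algebraMap_mem _ (algebraMap A (homogeneousSubmodule (Fin k) A 0) a)
  | add _ _ _ _ h1 h2 => exact add_mem (h1 trivial) (h2 trivial)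
  | mul _ _ _ _ h1 h2 => exact mul_mem (h1 trivial) (h2 trivial)

section Overlap

variable {L L' : MvPolynomial (Fin k) A} (hL : L ∈ homogeneousSubmodule (Fin k) A 1)
  (hL' : L' ∈ homogeneousSubmodule (Fin k) A 1)

/-- The affine open set where both `L ≠ 0` and `L' ≠ 0`. -/
def overlap : (projSpace A k).affineOpens :=
  ⟨Proj.basicOpen (homogeneousSubmodule (Fin k) A) (L * L'),
    Proj.isAffineOpen_basicOpen _ (L * L') (IsHomogeneous.mul hL hL') two_pos⟩

theorem overlap_eq_inf : (overlap hL hL').1 = (linOpen L hL).1 ⊓ (linOpen L' hL').1 :=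
  Proj.basicOpen_mul _ _ _

/-- Restriction from `L ≠ 0` to the set where both `L ≠ 0` and `L' ≠ 0`. -/
def resLeft : Γ(projSpace A k, (linOpen L hL).1) →+* Γ(projSpace A k, (overlap hL hL').1) :=
  ((projSpace A k).presheaf.map
    (homOfLE ((overlap_eq_inf hL hL').trans_le inf_le_left)).op).hom

/-- Restriction from `L' ≠ 0` to the set where both `L ≠ 0` and `L' ≠ 0`. -/
def resRight : Γ(projSpace A k, (linOpen L' hL').1) →+* Γ(projSpace A k, (overlap hL hL').1) :=
  ((projSpace A k).presheaf.map
    (homOfLE ((overlap_eq_inf hL hL').trans_le inf_le_right)).op).hom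

theorem resLeft_linSec {n : ℕ} {b : MvPolynomial (Fin k) A}
    (hb : b ∈ homogeneousSubmodule (Fin k) A n) :
    resLeft hL hL' (linSec L hL b) =
      resLeft hL hL' (linSec L hL L') ^ n * resRight hL hL' (linSec L' hL' b) := by
  have h1 := Proj.awayMap_awayToSection (homogeneousSubmodule (Fin k) A) hL' (f := L) rfl
  have h2 := Proj.awayMap_awayToSection (homogeneousSubmodule (Fin k) A) hL (f := L') (mul_comm L L')
  have h1' := fun z => (ConcreteCategory.congr_hom h1 z).symm
  have h2' := fun z => (ConcreteCategory.congr_hom h2 z).symm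
  refine (h1' _).trans ?_
  have h3 := congrArg (Proj.awayToSection (homogeneousSubmodule (Fin k) A) (L * L')).hom
    (awayMap_awayDehom hL hL' hb)
  rw [map_mul, map_pow] at h3
  have e1 : resLeft hL hL' (linSec L hL L') = _ := h1' (awayDehom L hL L')
  have e2 : resRight hL hL' (linSec L' hL' b) = _ := h2' (awayDehom L' hL' b)
  rw [e1, e2]
  exact h3

theorem linSec_self : linSec L hL L = 1 := by
  change (Proj.awayToSection _ L).hom (awayDehom L hL L) = 1
  rw [awayDehom_self, map_one]

theorem isUnit_resLeft_linSec : IsUnit (resLeft hL hL' (linSec L hL L')) := by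
  have h := resLeft_linSec hL hL' hL
  rw [linSec_self, pow_one, map_one] at h
  exact IsUnit.of_mul_eq_one _ h.symm

end Overlap

end ProjectiveCharts

/-! ### The ideal sheaf of {J = 0} on the charts. -/

section ProjIdeal

variable {A : Type u} [CommRing A] {k : ℕ}

theorem awayToSection_SpecMap_awayι_appLE {σ : Type*} {B : Type u} [CommRing B] [SetLike σ B]
    [AddSubgroupClass σ B] (𝒜 : ℕ → σ) [GradedRing 𝒜] (f : B) {m : ℕ} (hf : f ∈ 𝒜 m) (hm : 0 < m)
    {S : CommRingCat.{u}} (φ : CommRingCat.of (HomogeneousLocalization.Away 𝒜 f) ⟶ S)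
    (h : ⊤ ≤ (Spec.map φ ≫ Proj.awayι 𝒜 f hf hm) ⁻¹ᵁ Proj.basicOpen 𝒜 f)
    (h' : ⊤ ≤ Proj.awayι 𝒜 f hf hm ⁻¹ᵁ Proj.basicOpen 𝒜 f) :
    Proj.awayToSection 𝒜 f ≫
        (Spec.map φ ≫ Proj.awayι 𝒜 f hf hm).appLE (Proj.basicOpen 𝒜 f) ⊤ h =
      φ ≫ (Scheme.ΓSpecIso S).inv := by
  have h1 := Scheme.Hom.appLE_comp_appLE (Spec.map φ) (Proj.awayι 𝒜 f hf hm)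
    (Proj.basicOpen 𝒜 f) ⊤ ⊤ h' le_rfl
  rw [← h1, ← Category.assoc, awayToSection_awayι_appLE, Scheme.ΓSpecIso_inv_naturality]
  exact congrArg _ (Scheme.Hom.appLE_eq_app (Spec.map φ) (U := ⊤))

theorem app_eq_zero_iff_of_le {X Y : Scheme.{u}} (f : X ⟶ Y) {U V : Y.Opens} (hVU : V ≤ U)
    (h : f ⁻¹ᵁ U ≤ f ⁻¹ᵁ V) (s : Γ(Y, U)) :
    f.app U s = 0 ↔ f.app V (Y.presheaf.map (homOfLE hVU).op s) = 0 := by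
  have h1 : f.app V (Y.presheaf.map (homOfLE hVU).op s) =
      X.presheaf.map (homOfLE (show f ⁻¹ᵁ V ≤ f ⁻¹ᵁ U from fun x hx => hVU hx)).op (f.app U s) :=
    ConcreteCategory.congr_hom (f.naturality (homOfLE hVU).op) s
  rw [h1]
  constructor
  · intro h0; rw [h0, map_zero]
  · intro h0
    have h2 := congrArg (X.presheaf.map (homOfLE h).op) h0
    rw [map_zero, ← ConcreteCategory.comp_apply, ← Functor.map_comp] at h2
    have h3 : (homOfLE (show f ⁻¹ᵁ V ≤ f ⁻¹ᵁ U from fun x hx => hVU hx)).op ≫ (homOfLE h).op =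
      𝟙 _ := Subsingleton.elim _ _
    rw [h3] at h2
    simpa using h2

theorem app_eq_zero_iff_appLE {X Y : Scheme.{u}} (f : X ⟶ Y) {U : Y.Opens}
    (h : ⊤ ≤ f ⁻¹ᵁ U) (s : Γ(Y, U)) : f.app U s = 0 ↔ f.appLE U ⊤ h s = 0 := by
  have h1 : f.appLE U ⊤ h s = X.presheaf.map (homOfLE h).op (f.app U s) := rfl
  rw [h1]
  constructor
  · intro h0; rw [h0, map_zero]
  · intro h0
    have h2 := congrArg (X.presheaf.map (homOfLE le_top : f ⁻¹ᵁ U ⟶ ⊤).op) h0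
    rw [map_zero, ← ConcreteCategory.comp_apply, ← Functor.map_comp] at h2
    have h3 : (homOfLE h).op ≫ (homOfLE le_top : f ⁻¹ᵁ U ⟶ ⊤).op = 𝟙 _ := Subsingleton.elim _ _
    rw [h3] at h2
    simpa using h2

theorem SpecMap_awayι_app_eq_zero_iff {σ : Type*} {B : Type u} [CommRing B] [SetLike σ B]
    [AddSubgroupClass σ B] (𝒜 : ℕ → σ) [GradedRing 𝒜] (f : B) {m : ℕ} (hf : f ∈ 𝒜 m) (hm : 0 < m)
    (I : Ideal (HomogeneousLocalization.Away 𝒜 f))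
    (h : ⊤ ≤ (Spec.map (CommRingCat.ofHom (Ideal.Quotient.mk I)) ≫ Proj.awayι 𝒜 f hf hm) ⁻¹ᵁ
      Proj.basicOpen 𝒜 f)
    (h' : ⊤ ≤ Proj.awayι 𝒜 f hf hm ⁻¹ᵁ Proj.basicOpen 𝒜 f)
    (z : HomogeneousLocalization.Away 𝒜 f) :
    (Spec.map (CommRingCat.ofHom (Ideal.Quotient.mk I)) ≫ Proj.awayι 𝒜 f hf hm).app
      (Proj.basicOpen 𝒜 f) ((Proj.awayToSection 𝒜 f).hom z) = 0 ↔ z ∈ I := by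
  rw [app_eq_zero_iff_appLE _ h]
  have h1 := congrArg (fun φ => φ.hom z) (awayToSection_SpecMap_awayι_appLE 𝒜 f hf hm
    (CommRingCat.ofHom (Ideal.Quotient.mk I)) h h')
  simp only [CommRingCat.hom_comp, RingHom.comp_apply, CommRingCat.hom_ofHom] at h1
  rw [h1, ← Ideal.Quotient.eq_zero_iff_mem]
  exact map_eq_zero_iff _ (ConcreteCategory.bijective_of_isIso (Scheme.ΓSpecIso _).inv).1

/-- The inclusion of the part of `{J = 0}` in the standard chart `y_i ≠ 0`. -/
def chartSubscheme (J : Ideal (MvPolynomial (Fin k) A)) (i : Fin k) :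
    Spec (CommRingCat.of (HomogeneousLocalization.Away (homogeneousSubmodule (Fin k) A) (X i) ⧸
      chartIdeal J i)) ⟶ projSpace A k :=
  Spec.map (CommRingCat.ofHom (Ideal.Quotient.mk (chartIdeal J i))) ≫ chart i

instance (J : Ideal (MvPolynomial (Fin k) A)) (i : Fin k) : QuasiCompact (chartSubscheme J i) :=
  quasiCompact_of_compactSpace _

instance (i : Fin k) : IsOpenImmersion (chart i : _ ⟶ projSpace A k) :=
  inferInstanceAs (IsOpenImmersion (Proj.awayι (homogeneousSubmodule (Fin k) A) (X i) (m := 1)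
    (X_mem_one i) one_pos))

theorem chart_preimage_linOpen (i : Fin k) :
    (chart i : _ ⟶ projSpace A k) ⁻¹ᵁ (linOpen (X i) (X_mem_one i)).1 = ⊤ := by
  have : (linOpen (X i) (X_mem_one i)).1 = (chart i : _ ⟶ projSpace A k).opensRange :=
    (Proj.opensRange_awayι _ _ _ _).symm
  rw [this]
  simp

theorem chartSubscheme_preimage_linOpen (J : Ideal (MvPolynomial (Fin k) A)) (i : Fin k) :
    chartSubscheme J i ⁻¹ᵁ (linOpen (X i) (X_mem_one i)).1 = ⊤ := by
  rw [chartSubscheme, Scheme.Hom.comp_preimage, chart_preimage_linOpen]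
  rfl

theorem chartSubscheme_app_eq_zero_iff (J : Ideal (MvPolynomial (Fin k) A)) (i : Fin k)
    (z : HomogeneousLocalization.Away (homogeneousSubmodule (Fin k) A) (X i)) :
    (chartSubscheme J i).app (linOpen (X i) (X_mem_one i)).1 (awaySec (X i) (X_mem_one i) z) = 0 ↔
      z ∈ chartIdeal J i :=
  SpecMap_awayι_app_eq_zero_iff (homogeneousSubmodule (Fin k) A) (X i) (m := 1)
    (X_mem_one i) one_pos (chartIdeal J i) (chartSubscheme_preimage_linOpen J i).ge
    (chart_preimage_linOpen i).ge z

/-- The sheaf is an intersection over all charts. The i-th term alone gives one inclusion; for the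
other, a homogeneous element of J dehomogenized at y_i must also vanish on the parts of {J = 0}
lying in the other charts, which follows from the transition rule. -/
theorem projIdeal_ideal_X {J : Ideal (MvPolynomial (Fin k) A)}
    (hJ : J.IsHomogeneous (homogeneousSubmodule (Fin k) A)) (i : Fin k) :
    (projIdeal J).ideal (linOpen (X i) (X_mem_one i)) =
      J.map (linSec (X i) (X_mem_one i)) := by
  have hker : ∀ j, (chartSubscheme J j).ker.ideal (linOpen (X i) (X_mem_one i)) =
      RingHom.ker ((chartSubscheme J j).app (linOpen (X i) (X_mem_one i)).1).hom :=
    fun j => Scheme.Hom.ker_apply _ _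
  have hmem : ∀ j, ∀ b ∈ J, (chartSubscheme J j).app (linOpen (X j) (X_mem_one j)).1
      (linSec (X j) (X_mem_one j) b) = 0 := by
    intro j b hb
    refine (chartSubscheme_app_eq_zero_iff J j _).2 ?_
    rw [chartIdeal_eq_map hJ]
    exact Ideal.mem_map_of_mem _ hb
  have hdef : (projIdeal J).ideal (linOpen (X i) (X_mem_one i)) =
      ⨅ j, (chartSubscheme J j).ker.ideal (linOpen (X i) (X_mem_one i)) := by
    have := congrFun (Scheme.IdealSheafData.ideal_iInf (fun j => (chartSubscheme J j).ker))
      (linOpen (X i) (X_mem_one i))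
    rw [iInf_apply] at this
    exact this
  rw [hdef]
  apply le_antisymm
  · refine (iInf_le _ i).trans ?_
    rw [hker]
    intro s hs
    obtain ⟨z, rfl⟩ := (bijective_awaySec (X_mem_one i)).2 s
    have hz := (chartSubscheme_app_eq_zero_iff J i z).1 hs
    rw [chartIdeal_eq_map hJ] at hz
    have := Ideal.mem_map_of_mem (awaySec (X i) (X_mem_one i)) hz
    rw [Ideal.map_map] at this
    exact this
  · refine le_iInf fun j => ?_
    rw [hker]
    refine map_le_of_homogeneous hJ _ _ fun n b hb hbn => ?_
    have hi := X_mem_one (A := A) i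
    have hj := X_mem_one (A := A) j
    -- The source of `chartSubscheme J j` lies over y_j ≠ 0, so vanishing over y_i ≠ 0 can be tested
    -- on the overlap.
    have hle : chartSubscheme J j ⁻¹ᵁ (linOpen (X i) hi).1 ≤
        chartSubscheme J j ⁻¹ᵁ (overlap hi hj).1 := by
      rw [overlap_eq_inf]
      intro x hx
      exact ⟨hx, (chartSubscheme_preimage_linOpen J j).ge trivial⟩
    refine (app_eq_zero_iff_of_le _ ((overlap_eq_inf hi hj).trans_le inf_le_left) hle _).2 ?_
    change (chartSubscheme J j).app (overlap hi hj).1 (resLeft hi hj (linSec (X i) hi b)) = 0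
    have h0 : (chartSubscheme J j).app (overlap hi hj).1
        (resRight hi hj (linSec (X j) hj b)) = 0 := by
      have h1 : (chartSubscheme J j).app (overlap hi hj).1
          (resRight hi hj (linSec (X j) hj b)) = _ :=
        ConcreteCategory.congr_hom ((chartSubscheme J j).naturality
          (homOfLE ((overlap_eq_inf hi hj).trans_le inf_le_right)).op) _
      rw [h1]
      rw [CommRingCat.comp_apply, hmem j b hb, map_zero]
    rw [resLeft_linSec hi hj hbn, map_mul, h0, mul_zero]

/-- Equality is checked at stalks. Each point of L ≠ 0 lies in some chart y_i ≠ 0, and on the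
overlap the two dehomogenizations of a form of degree n differ by the n-th power of the unit y_i /
L. -/
theorem projIdeal_ideal {J : Ideal (MvPolynomial (Fin k) A)}
    (hJ : J.IsHomogeneous (homogeneousSubmodule (Fin k) A)) {L : MvPolynomial (Fin k) A}
    (hL : L ∈ homogeneousSubmodule (Fin k) A 1) :
    (projIdeal J).ideal (linOpen L hL) = J.map (linSec L hL) := by
  rw [(linOpen L hL).2.ideal_ext_iff]
  intro x hx
  obtain ⟨i, hi⟩ := TopologicalSpace.Opens.mem_iSup.1
    (show x ∈ ⨆ i : Fin k, (linOpen (X i : MvPolynomial (Fin k) A) (X_mem_one i)).1 from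
      iSup_linOpen_X (A := A) (k := k) ▸ trivial)
  have hX := X_mem_one (A := A) i
  have hxO : x ∈ (overlap hL hX).1 := by rw [overlap_eq_inf]; exact ⟨hx, hi⟩
  have g1 : ((projSpace A k).presheaf.germ (linOpen L hL).1 x hx).hom =
      ((projSpace A k).presheaf.germ (overlap hL hX).1 x hxO).hom.comp (resLeft hL hX) := by
    rw [resLeft, ← CommRingCat.hom_comp, TopCat.Presheaf.germ_res]
  have g2 : ((projSpace A k).presheaf.germ (linOpen (X i) hX).1 x hi).hom =
      ((projSpace A k).presheaf.germ (overlap hL hX).1 x hxO).hom.comp (resRight hL hX) := by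
    rw [resRight, ← CommRingCat.hom_comp, TopCat.Presheaf.germ_res]
  have e1 : ((projIdeal J).ideal (linOpen L hL)).map (resLeft hL hX) =
      (projIdeal J).ideal (overlap hL hX) :=
    (projIdeal J).map_ideal (U := overlap hL hX) (V := linOpen L hL)
      ((overlap_eq_inf hL hX).trans_le inf_le_left)
  have e2 : ((projIdeal J).ideal (linOpen (X i) hX)).map (resRight hL hX) =
      (projIdeal J).ideal (overlap hL hX) :=
    (projIdeal J).map_ideal (U := overlap hL hX) (V := linOpen (X i) hX)
      ((overlap_eq_inf hL hX).trans_le inf_le_right)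
  have e3 : (J.map (linSec L hL)).map (resLeft hL hX) =
      (J.map (linSec (X i) hX)).map (resRight hL hX) := by
    rw [Ideal.map_map, Ideal.map_map]
    have hu := isUnit_resLeft_linSec hL hX
    apply le_antisymm
    · refine map_le_of_homogeneous hJ _ _ fun n b hb hbn => ?_
      rw [RingHom.comp_apply, resLeft_linSec hL hX hbn]
      exact Ideal.mul_mem_left _ _
        (Ideal.mem_map_of_mem ((resRight hL hX).comp (linSec (X i) hX)) hb)
    · refine map_le_of_homogeneous hJ _ _ fun n b hb hbn => ?_
      rw [← Ideal.unit_mul_mem_iff_mem _ (hu.pow n), RingHom.comp_apply,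
        ← resLeft_linSec hL hX hbn]
      exact Ideal.mem_map_of_mem ((resLeft hL hX).comp (linSec L hL)) hb
  rw [g1, ← Ideal.map_map, ← Ideal.map_map, e1, e3, ← e2, projIdeal_ideal_X hJ i]

end ProjIdeal

/-! ### Differentials, Jacobian minors and Euler's identity. -/

section Jacobian

variable {A : Type u} [CommRing A] {k : ℕ}

theorem exists_derivation_of_surjective {B : Type*} [CommRing B] [Algebra A B]
    {P M : Type*} [CommRing P] [Algebra A P] [AddCommGroup M] [Module B M] [Module A M]
    [IsScalarTower A B M]
    (σ : P →ₐ[A] B) (hσ : Function.Surjective σ) (δ : P →ₗ[A] M)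
    (hδ : ∀ p q, δ (p * q) = σ p • δ q + σ q • δ p) (h0 : ∀ p, σ p = 0 → δ p = 0) :
    ∃ d : Derivation A B M, ∀ p, d (σ p) = δ p := by
  let e := σ.toLinearMap.quotKerEquivOfSurjective hσ
  let d : B →ₗ[A] M := ((LinearMap.ker σ.toLinearMap).liftQ δ fun p hp => h0 p hp) ∘ₗ
    e.symm.toLinearMap
  have hd : ∀ p, d (σ p) = δ p := by
    intro p
    have : e.symm (σ p) = (LinearMap.ker σ.toLinearMap).mkQ p := by
      rw [LinearEquiv.symm_apply_eq]; rfl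
    simp only [d, LinearMap.comp_apply, LinearEquiv.coe_coe, this]
    rfl
  refine ⟨Derivation.mk' d fun a b => ?_, hd⟩
  obtain ⟨p, rfl⟩ := hσ a
  obtain ⟨q, rfl⟩ := hσ b
  rw [← map_mul, hd, hd, hd, hδ]

theorem D_comp_eq_sum {B : Type*} [CommRing B] [Algebra A B] (σ : MvPolynomial (Fin k) A →ₐ[A] B)
    (p : MvPolynomial (Fin k) A) :
    KaehlerDifferential.D A B (σ p) =
      ∑ l, σ (pderiv l p) • KaehlerDifferential.D A B (σ (X l)) := by
  induction p using MvPolynomial.induction_on with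
  | C a => simp [← algebraMap_eq]
  | add p q hp hq => simp only [map_add, hp, hq, add_smul, Finset.sum_add_distrib]
  | mul_X p i hp =>
    simp only [map_mul, Derivation.leibniz, hp, pderiv_X, smul_eq_mul, map_add, add_smul,
      Finset.sum_add_distrib, mul_smul, Finset.smul_sum]
    congr 1
    · rw [Finset.sum_eq_single i]
      · simp
      · intro b _ hb; simp [Ne.symm hb]
      · simp

/-- The Fitting ideal of the differentials of an algebra with `k` generators and `m` relations. -/
theorem fittingIdeal_kaehlerDifferential {B : Type*} [CommRing B] [Algebra A B]
    (σ : MvPolynomial (Fin k) A →ₐ[A] B) (hσ : Function.Surjective σ) {m : ℕ}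
    (G : Fin m → MvPolynomial (Fin k) A) (hG : RingHom.ker σ = Ideal.span (Set.range G)) :
    fittingIdeal B (Ω[B⁄A]) ((k : ℤ) - m) =
      Ideal.span (Set.range fun c : Fin m → Fin k =>
        σ (Matrix.det (Matrix.of fun a b => pderiv (c b) (G a)))) := by
  have hG0 : ∀ a, σ (G a) = 0 := fun a => by
    rw [← RingHom.mem_ker, hG]; exact Ideal.subset_span ⟨a, rfl⟩
  let x : Fin k → Ω[B⁄A] := fun l => KaehlerDifferential.D A B (σ (X l))
  have hx : Submodule.span B (Set.range x) = ⊤ := by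
    rw [eq_top_iff, ← KaehlerDifferential.span_range_derivation, Submodule.span_le]
    rintro _ ⟨b, rfl⟩
    obtain ⟨p, rfl⟩ := hσ b
    rw [D_comp_eq_sum]
    exact Submodule.sum_mem _ fun l _ => Submodule.smul_mem _ _ (Submodule.subset_span ⟨l, rfl⟩)
  let ρ : Fin m → Fin k → B := fun a l => σ (pderiv l (G a))
  let N := Submodule.span B (Set.range ρ)
  have hker : LinearMap.ker (Fintype.linearCombination B x) = N := by
    apply le_antisymm
    -- The gradient modulo the rows of the Jacobian matrix kills the ideal of relations, so it
    -- descends to a derivation of B. The induced linear map on Ω sends ∑ b_l dx_l to the class of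
    -- b, hence relations among the dx_l are combinations of the rows.
    · let δ₀ : MvPolynomial (Fin k) A →ₗ[A] (Fin k → B) :=
        LinearMap.pi fun l => σ.toLinearMap ∘ₗ (pderiv l).toLinearMap
      have hδ₀ : ∀ p q, δ₀ (p * q) = σ p • δ₀ q + σ q • δ₀ p := by
        intro p q; ext l; simp [δ₀]
      have hN : ∀ p, σ p = 0 → δ₀ p ∈ N := by
        intro p hp
        rw [← RingHom.mem_ker, hG] at hp
        induction hp using Submodule.span_induction with
        | mem _ h => obtain ⟨a, rfl⟩ := h; exact Submodule.subset_span ⟨a, rfl⟩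
        | zero => simp
        | add _ _ _ _ h h' => rw [map_add]; exact add_mem h h'
        | smul q p hp' h =>
          have : σ p = 0 := by rw [← RingHom.mem_ker, hG]; exact hp'
          rw [smul_eq_mul, hδ₀, this, zero_smul, add_zero]
          exact Submodule.smul_mem _ _ h
      obtain ⟨d, hd⟩ := exists_derivation_of_surjective σ hσ (N.mkQ.restrictScalars A ∘ₗ δ₀)
        (fun p q => by simp [hδ₀]) (fun p hp => by simpa using hN p hp)
      intro b hb
      have h1 : d.liftKaehlerDifferential (Fintype.linearCombination B x b) = N.mkQ b := by
        rw [Fintype.linearCombination_apply, map_sum]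
        conv_rhs => rw [pi_eq_sum_univ' b, map_sum]
        refine Finset.sum_congr rfl fun l _ => ?_
        rw [map_smul, map_smul, Derivation.liftKaehlerDifferential_comp_D, hd]
        congr 1
        change N.mkQ (δ₀ (X l)) = _
        congr 1
        ext l'
        by_cases h : l = l'
        · subst h; simp [δ₀]
        · simp [δ₀, pderiv_X, h, Ne.symm h]
      rw [LinearMap.mem_ker.1 hb, map_zero] at h1
      simpa using h1.symm
    · refine Submodule.span_le.2 ?_
      rintro _ ⟨a, rfl⟩
      have := D_comp_eq_sum σ (G a)
      rw [hG0, map_zero] at this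
      simpa [Fintype.linearCombination_apply, ρ, x] using this.symm
  rw [fittingIdeal_eq_span_minors x hx ρ hker]
  congr 2
  ext c
  rw [AlgHom.map_det]
  rfl

/-- The minors of the Jacobian matrix with respect to the homogeneous coordinates, compared with the
minors for the equations in an affine chart. -/
theorem span_minors_cons_eq {B : Type*} [CommRing B] (σ : MvPolynomial (Fin k) A →+* B) {r : ℕ}
    (F : Fin r → MvPolynomial (Fin k) A) (p : Fin r → ℕ) (hF : ∀ j, (F j).IsHomogeneous (p j))
    (hσF : ∀ j, σ (F j) = 0) (i : Fin k) (hi : σ (X i) = 1) :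
    Ideal.span (Set.range fun c : Fin (r + 1) → Fin k =>
        σ (Matrix.det (Matrix.of fun a b =>
          pderiv (c b) (Fin.cons (α := fun _ => MvPolynomial (Fin k) A) (X i - 1) F a)))) =
      (jacobianMinors F).map σ := by
  rw [jacobianMinors, Ideal.map_span, ← Set.range_comp]
  apply le_antisymm
  · rw [Ideal.span_le]
    rintro _ ⟨c, rfl⟩
    simp only [SetLike.mem_coe]
    rw [Matrix.det_succ_row_zero, map_sum]
    refine Ideal.sum_mem _ fun l _ => ?_
    rw [map_mul]
    refine Ideal.mul_mem_left _ _ (Ideal.subset_span ⟨c ∘ l.succAbove, ?_⟩)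
    rfl
  · rw [Ideal.span_le]
    rintro _ ⟨c, rfl⟩
    let H : Fin (r + 1) → MvPolynomial (Fin k) A := Fin.cons (X i - 1) F
    -- Put a column l in front of the columns c, weight by y_l and sum over l. The first column
    -- becomes ∑ y_l ∂_l H_a, which is y_i = 1 for a = 0 and p_j F_j = 0 otherwise by Euler, so only
    -- the minor with columns c survives.
    have key : σ (Matrix.det (Matrix.of fun a b => pderiv (c b) (F a))) =
        ∑ l, σ (X l) * σ (Matrix.det (Matrix.of fun a b =>
          pderiv ((Fin.cons l c : Fin (r + 1) → Fin k) b) (H a))) := by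
      simp only [Matrix.det_succ_column_zero, map_sum, Finset.mul_sum]
      rw [Finset.sum_comm, Fin.sum_univ_succ]
      have h0 : ∀ a : Fin (r + 1), ∑ l, σ (X l) * σ (pderiv l (H a)) =
          if a = 0 then 1 else 0 := by
        intro a
        cases a using Fin.cases with
        | zero =>
          rw [Finset.sum_eq_single i]
          · simp [H, hi]
          · intro l _ hl; simp [H, pderiv_X, Ne.symm hl]
          · simp
        | succ a =>
          have := congrArg σ (IsHomogeneous.sum_X_mul_pderiv (hF a))
          simpa [H, hσF] using this
      have h1 : ∀ a : Fin (r + 1), ∑ l, σ (X l) * σ ((-1) ^ (a : ℕ) *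
          (Matrix.of fun a b => pderiv ((Fin.cons l c : Fin (r + 1) → Fin k) b) (H a)) a 0 *
          (Matrix.submatrix (Matrix.of fun a b =>
            pderiv ((Fin.cons l c : Fin (r + 1) → Fin k) b) (H a)) a.succAbove Fin.succ).det) =
          (if a = 0 then 1 else 0) * ((-1) ^ (a : ℕ) * σ (Matrix.det (Matrix.of fun a' b =>
            pderiv (c b) (H (a.succAbove a'))))) := by
        intro a
        rw [← h0 a, Finset.sum_mul]
        refine Finset.sum_congr rfl fun l _ => ?_
        simp only [map_mul, map_pow, map_neg, map_one, Matrix.of_apply, Fin.cons_zero]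
        have : (Matrix.submatrix (Matrix.of fun a b =>
            pderiv ((Fin.cons l c : Fin (r + 1) → Fin k) b) (H a)) a.succAbove Fin.succ) =
            Matrix.of fun a' b => pderiv (c b) (H (a.succAbove a')) := by
          ext a' b; simp
        rw [this]
        ring
      simp only [h1]
      simp [H, Fin.succ_ne_zero]
    change σ _ ∈ _
    rw [key]
    exact Ideal.sum_mem _ fun l _ => Ideal.mul_mem_left _ _ (Ideal.subset_span ⟨_, rfl⟩)

end Jacobian

/-! ### The Fitting ideals of the differentials form an ideal sheaf. -/

section CriticalLocus

variable {A : Type u} [CommRing A]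

theorem finiteType_sections {X : Scheme.{u}} (π : X ⟶ Spec (CommRingCat.of A))
    [LocallyOfFiniteType π] (U : X.affineOpens) :
    @Algebra.FiniteType A Γ(X, U) _ _ (sectionsAlgebra π U) := by
  have h1 := π.finiteType_appLE (isAffineOpen_top _) U.2 (le_top : U.1 ≤ π ⁻¹ᵁ ⊤)
  have h2 : RingHom.FiniteType (Scheme.ΓSpecIso (CommRingCat.of A)).inv.hom :=
    RingHom.FiniteType.of_surjective _ (ConcreteCategory.bijective_of_isIso
      (Scheme.ΓSpecIso (CommRingCat.of A)).inv).2
  exact h1.comp h2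

/-- Differentials localize, and Fitting ideals commute with base change; finite type makes the
differentials a finite module. -/
theorem fittingIdeal_kaehlerDifferential_basicOpen {X : Scheme.{u}}
    (π : X ⟶ Spec (CommRingCat.of A)) [LocallyOfFiniteType π] (d : ℤ) (U : X.affineOpens)
    (f : Γ(X, U)) :
    (letI : Algebra A Γ(X, U) := sectionsAlgebra π U;
      fittingIdeal Γ(X, U) (Ω[Γ(X, U)⁄A]) d).map
        (X.presheaf.map (homOfLE (X.basicOpen_le f)).op).hom =
      letI : Algebra A Γ(X, X.basicOpen f) := sectionsAlgebra π (X.basicOpen f)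
      fittingIdeal Γ(X, X.basicOpen f) (Ω[Γ(X, X.basicOpen f)⁄A]) d := by
  let : Algebra A Γ(X, U) := sectionsAlgebra π U
  let : Algebra A Γ(X, X.basicOpen f) := sectionsAlgebra π (X.basicOpen f)
  have : IsScalarTower A Γ(X, U) Γ(X, X.basicOpen f) := by
    refine IsScalarTower.of_algebraMap_eq' ?_
    change ((Scheme.ΓSpecIso (CommRingCat.of A)).inv ≫ π.appTop ≫
      X.presheaf.map (homOfLE (le_top : X.basicOpen f ≤ ⊤)).op).hom =
      (((Scheme.ΓSpecIso (CommRingCat.of A)).inv ≫ π.appTop ≫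
      X.presheaf.map (homOfLE (le_top : U.1 ≤ ⊤)).op) ≫
      X.presheaf.map (homOfLE (X.basicOpen_le f)).op).hom
    rw [Category.assoc, Category.assoc, ← Functor.map_comp]
    rfl
  have := U.2.isLocalization_basicOpen f
  have : Algebra.FiniteType A Γ(X, U) := finiteType_sections π U
  have h := KaehlerDifferential.isLocalizedModule_map A Γ(X, U) Γ(X, X.basicOpen f)
    (Submonoid.powers f)
  exact (fittingIdeal_baseChange _ ((isLocalizedModule_iff_isBaseChange (Submonoid.powers f)
    Γ(X, X.basicOpen f) _).1 h) d).symm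

/-- `ofIdeals` is the largest ideal sheaf contained in a family of ideals. The family here is
compatible with passage to basic opens, so nothing is lost. -/
theorem criticalIdeal_ideal {X : Scheme.{u}} (π : X ⟶ Spec (CommRingCat.of A))
    [LocallyOfFiniteType π] (d : ℤ) (U : X.affineOpens) :
    (criticalIdeal π d).ideal U =
      letI : Algebra A Γ(X, U) := sectionsAlgebra π U
      fittingIdeal Γ(X, U) (Ω[Γ(X, U)⁄A]) d := by
  let I : X.IdealSheafData := ⟨fun U =>
    letI : Algebra A Γ(X, U) := sectionsAlgebra π U
    fittingIdeal Γ(X, U) (Ω[Γ(X, U)⁄A]) d,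
    fittingIdeal_kaehlerDifferential_basicOpen π d, _, rfl⟩
  exact congr($(Scheme.IdealSheafData.ofIdeals_ideal I).ideal U)

end CriticalLocus

/-! ### Functions on the charts of a closed subscheme, as A-algebras. -/

section Sections

theorem awayι_preimage_basicOpen_self {σ : Type*} {B : Type u} [CommRing B] [SetLike σ B]
    [AddSubgroupClass σ B] (𝒜 : ℕ → σ) [GradedRing 𝒜] (f : B) {m : ℕ} (hf : f ∈ 𝒜 m) (hm : 0 < m) :
    Proj.awayι 𝒜 f hf hm ⁻¹ᵁ Proj.basicOpen 𝒜 f = ⊤ := by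
  rw [← Proj.opensRange_awayι 𝒜 f hf hm]
  simp

/-- Needed to see that the algebra structure induced by the projection to the base is the one by
constants, so that dehomogenization is a map of algebras over the base. -/
theorem structure_awayToSection {σ : Type*} {B : Type u} [CommRing B] [SetLike σ B]
    [AddSubgroupClass σ B] (𝒜 : ℕ → σ) [GradedRing 𝒜] (f : B) {m : ℕ} (hf : f ∈ 𝒜 m) (hm : 0 < m)
    {S : CommRingCat.{u}} (φ : S ⟶ CommRingCat.of (𝒜 0)) :
    (Scheme.ΓSpecIso S).inv ≫
        (Proj.toSpecZero 𝒜 ≫ Spec.map φ).appLE ⊤ (Proj.basicOpen 𝒜 f) le_top =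
      (φ ≫ CommRingCat.ofHom (HomogeneousLocalization.fromZeroRingHom 𝒜 (Submonoid.powers f))) ≫
        Proj.awayToSection 𝒜 f := by
  have hp := (awayι_preimage_basicOpen_self 𝒜 f hf hm).ge
  have h1 := awayToSection_awayι_appLE 𝒜 f hf hm hp
  have := isIso_awayToSection 𝒜 f hf hm
  have : IsIso ((Proj.awayι 𝒜 f hf hm).appLE (Proj.basicOpen 𝒜 f) ⊤ hp) := by
    have : IsIso (Proj.awayToSection 𝒜 f ≫
        (Proj.awayι 𝒜 f hf hm).appLE (Proj.basicOpen 𝒜 f) ⊤ hp) := by rw [h1]; infer_instance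
    exact IsIso.of_isIso_comp_left (Proj.awayToSection 𝒜 f) _
  rw [← cancel_mono ((Proj.awayι 𝒜 f hf hm).appLE (Proj.basicOpen 𝒜 f) ⊤ hp), Category.assoc,
    Category.assoc, h1]
  have h2 := Scheme.Hom.appLE_comp_appLE (Proj.awayι 𝒜 f hf hm)
    (Proj.toSpecZero 𝒜 ≫ Spec.map φ) ⊤ (Proj.basicOpen 𝒜 f) ⊤ le_top hp
  have h3 : Proj.awayι 𝒜 f hf hm ≫ Proj.toSpecZero 𝒜 ≫ Spec.map φ =
      Spec.map (φ ≫ CommRingCat.ofHom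
        (HomogeneousLocalization.fromZeroRingHom 𝒜 (Submonoid.powers f))) := by
    rw [Spec.map_comp, Proj.awayι_toSpecZero_assoc]
  rw [h2]
  have h4 : ∀ (g g' : Spec (CommRingCat.of (HomogeneousLocalization.Away 𝒜 f)) ⟶ Spec S)
      (_ : g = g') (h : ⊤ ≤ g ⁻¹ᵁ ⊤), g.appLE ⊤ ⊤ h = g'.appTop := by
    rintro g _ rfl h; exact Scheme.Hom.appLE_eq_app _
  rw [h4 _ _ h3, Scheme.ΓSpecIso_inv_naturality]

variable {A : Type u} [CommRing A] {k : ℕ}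

variable {Z : Scheme.{u}} (ι : Z ⟶ projSpace A k) (L : MvPolynomial (Fin k) A)
  (hL : L ∈ homogeneousSubmodule (Fin k) A 1)

theorem algebraMap_sections_eq (a : A) :
    (sectionsAlgebra (ι ≫ projSpaceToSpec A k) (ι ⁻¹ᵁ (linOpen L hL).1)).algebraMap a =
      ι.app (linOpen L hL).1 (linSec L hL (C a)) := by
  have h1 := congrArg (fun φ => φ.hom a) (structure_awayToSection
    (homogeneousSubmodule (Fin k) A) L hL one_pos
    (CommRingCat.ofHom (algebraMap A (homogeneousSubmodule (Fin k) A 0))))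
  have h2 : linSec L hL (C a) = (CommRingCat.Hom.hom
      ((Scheme.ΓSpecIso (CommRingCat.of A)).inv ≫ (projSpaceToSpec A k).appLE ⊤
        (linOpen L hL).1 le_top)) a := by
    refine Eq.trans ?_ h1.symm
    change awaySec L hL (awayDehom L hL (C a)) = _
    rw [awayDehom, coe_eval₂Hom, eval₂_C]
    rfl
  rw [h2]
  change CommRingCat.Hom.hom ((Scheme.ΓSpecIso (CommRingCat.of A)).inv ≫
      (ι ≫ projSpaceToSpec A k).appTop ≫ _) a = CommRingCat.Hom.hom
      (((Scheme.ΓSpecIso (CommRingCat.of A)).inv ≫ (projSpaceToSpec A k).appTop ≫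
        (projSpace A k).presheaf.map (homOfLE le_top).op) ≫ ι.app (linOpen L hL).1) a
  rw [Category.assoc, Category.assoc, ι.naturality, Scheme.Hom.comp_appTop, Category.assoc]
  rfl

/-- Dehomogenization with values in the functions on the part `L ≠ 0` of a scheme over the
projective space. -/
def schemeSec :
    letI := sectionsAlgebra (ι ≫ projSpaceToSpec A k) (ι ⁻¹ᵁ (linOpen L hL).1)
    MvPolynomial (Fin k) A →ₐ[A] Γ(Z, ι ⁻¹ᵁ (linOpen L hL).1) :=
  letI := sectionsAlgebra (ι ≫ projSpaceToSpec A k) (ι ⁻¹ᵁ (linOpen L hL).1)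
  { (ι.app (linOpen L hL).1).hom.comp (linSec L hL) with
    commutes' := fun a => (algebraMap_sections_eq ι L hL a).symm }

theorem schemeSec_surjective [IsClosedImmersion ι] : Function.Surjective (schemeSec ι L hL) :=
  (ι.app_surjective _ (linOpen L hL).2).comp (linSec_surjective hL)

/-- The presentation A[y]/(L - 1, J) of a chart, used with L = y_i for the differentials and with a
general L for the pushforward. -/
theorem ker_schemeSec [IsClosedImmersion ι] {J : Ideal (MvPolynomial (Fin k) A)}
    (hJ : J.IsHomogeneous (homogeneousSubmodule (Fin k) A)) (hι : ι.ker = projIdeal J) :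
    RingHom.ker (schemeSec ι L hL) = Ideal.span {L - 1} ⊔ J := by
  have h1 := Scheme.Hom.ker_apply ι (linOpen L hL)
  rw [hι, projIdeal_ideal hJ hL] at h1
  have h2 : RingHom.ker (schemeSec ι L hL) =
      (RingHom.ker (ι.app (linOpen L hL).1).hom).comap (linSec L hL) := rfl
  rw [h2, ← h1, Ideal.comap_map_of_surjective _ (linSec_surjective hL), ← ker_linSec hL, sup_comm]
  rfl

end Sections

/-! ### Equations of the critical locus. -/

section CriticalEquations

variable {A : Type u} [CommRing A] {k : ℕ}

theorem isHomogeneous_span {T : Set (MvPolynomial (Fin k) A)}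
    (hT : ∀ b ∈ T, ∃ n, b ∈ homogeneousSubmodule (Fin k) A n) :
    (Ideal.span T).IsHomogeneous (homogeneousSubmodule (Fin k) A) :=
  Ideal.homogeneous_span _ _ fun b hb => hT b hb

theorem isHomogeneous_span_range {r : ℕ} {F : Fin r → MvPolynomial (Fin k) A} {p : Fin r → ℕ}
    (hF : ∀ j, (F j).IsHomogeneous (p j)) :
    (Ideal.span (Set.range F)).IsHomogeneous (homogeneousSubmodule (Fin k) A) :=
  isHomogeneous_span (by rintro _ ⟨j, rfl⟩; exact ⟨p j, hF j⟩)

theorem isHomogeneous_jacobianMinors {r : ℕ} {F : Fin r → MvPolynomial (Fin k) A} {p : Fin r → ℕ}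
    (hF : ∀ j, (F j).IsHomogeneous (p j)) :
    (jacobianMinors F).IsHomogeneous (homogeneousSubmodule (Fin k) A) := by
  refine isHomogeneous_span ?_
  rintro _ ⟨c, rfl⟩
  refine ⟨∑ a, (p a - 1), ?_⟩
  beta_reduce
  rw [← Matrix.det_transpose, Matrix.det_apply]
  refine Submodule.sum_mem _ fun s _ => ?_
  rw [Units.smul_def]
  refine zsmul_mem ?_ _
  exact IsHomogeneous.prod _ _ _ fun a _ => (hF a).pderiv

/-- The equations of the ambient space, together with the minors of the Jacobian matrix. -/
abbrev critEquations {r : ℕ} (F : Fin r → MvPolynomial (Fin k) A) :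
    Ideal (MvPolynomial (Fin k) A) :=
  Ideal.span (Set.range F) ⊔ jacobianMinors F

theorem isHomogeneous_critEquations {r : ℕ} {F : Fin r → MvPolynomial (Fin k) A} {p : Fin r → ℕ}
    (hF : ∀ j, (F j).IsHomogeneous (p j)) :
    (critEquations F).IsHomogeneous (homogeneousSubmodule (Fin k) A) :=
  (isHomogeneous_span_range hF).sup (isHomogeneous_jacobianMinors hF)

instance (J : Ideal (MvPolynomial (Fin k) A)) : IsClosedImmersion (projSubschemeι J) :=
  inferInstanceAs (IsClosedImmersion (projIdeal J).subschemeι)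

instance (J : Ideal (MvPolynomial (Fin k) A)) (d : ℤ) : IsClosedImmersion (critι J d) :=
  inferInstanceAs (IsClosedImmersion
    ((criticalIdeal (projSubschemeToSpec J) d).subschemeι ≫ projSubschemeι J))

instance (J : Ideal (MvPolynomial (Fin k) A)) : LocallyOfFiniteType (projSubschemeToSpec J) :=
  inferInstanceAs (LocallyOfFiniteType (projSubschemeι J ≫ projSpaceToSpec A k))

theorem ker_projSubschemeι (J : Ideal (MvPolynomial (Fin k) A)) :
    (projSubschemeι J).ker = projIdeal J :=
  (projIdeal J).ker_subschemeι

theorem ker_subschemeι_comp_ideal {X Y : Scheme.{u}} (ι : X ⟶ Y) [IsAffineHom ι]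
    [QuasiCompact ι] (I : X.IdealSheafData) [QuasiCompact (I.subschemeι ≫ ι)] (U : Y.affineOpens) :
    (I.subschemeι ≫ ι).ker.ideal U =
      (I.ideal ⟨ι ⁻¹ᵁ U.1, U.2.preimage ι⟩).comap (ι.app U.1).hom := by
  rw [Scheme.Hom.ker_apply, ← Scheme.IdealSheafData.ker_subschemeι_app]
  refine (congrArg (fun φ => RingHom.ker (CommRingCat.Hom.hom φ))
    (Scheme.Hom.comp_app I.subschemeι ι U.1)).trans ?_
  exact (RingHom.comap_ker _ _).symm

theorem criticalIdeal_projSubscheme {r : ℕ} {F : Fin r → MvPolynomial (Fin k) A} {p : Fin r → ℕ}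
    (hF : ∀ j, (F j).IsHomogeneous (p j)) (i : Fin k) :
    (criticalIdeal (projSubschemeToSpec (Ideal.span (Set.range F))) ((k : ℤ) - 1 - r)).ideal
      ⟨projSubschemeι (Ideal.span (Set.range F)) ⁻¹ᵁ (linOpen (X i) (X_mem_one i)).1,
        (linOpen (X i) (X_mem_one i)).2.preimage _⟩ =
      (jacobianMinors F).map
        (((projSubschemeι (Ideal.span (Set.range F))).app (linOpen (X i) (X_mem_one i)).1).hom.comp
          (linSec (X i) (X_mem_one i))) := by
  have hX := X_mem_one (A := A) i
  have hJ := isHomogeneous_span_range hF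
  let ι := projSubschemeι (Ideal.span (Set.range F))
  rw [criticalIdeal_ideal]
  let : Algebra A Γ(projSubscheme (Ideal.span (Set.range F)), ι ⁻¹ᵁ (linOpen (X i) hX).1) :=
    sectionsAlgebra (ι ≫ projSpaceToSpec A k) (ι ⁻¹ᵁ (linOpen (X i) hX).1)
  let σ := schemeSec ι (X i) hX
  have hσ : Function.Surjective σ := schemeSec_surjective ι (X i) hX
  have hker : RingHom.ker σ = Ideal.span (Set.range
      (Fin.cons (X i - 1) F : Fin (r + 1) → MvPolynomial (Fin k) A)) := by
    rw [Fin.range_cons, Ideal.span_insert]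
    exact ker_schemeSec ι (X i) hX hJ (ker_projSubschemeι _)
  have h1 := fittingIdeal_kaehlerDifferential σ hσ _ hker
  -- The equation y_i - 1 of the chart is one more relation, which turns the index k - (r + 1) into
  -- the relative dimension k - 1 - r.
  rw [show (k : ℤ) - ((r + 1 : ℕ) : ℤ) = (k : ℤ) - 1 - r by push_cast; ring] at h1
  refine h1.trans ?_
  refine span_minors_cons_eq σ.toRingHom F p hF (fun j => ?_) i ?_
  · change F j ∈ RingHom.ker σ
    rw [hker]
    exact Ideal.subset_span ⟨j.succ, by simp⟩
  · have : X i - 1 ∈ RingHom.ker σ := by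
      rw [hker]; exact Ideal.subset_span ⟨0, by simp⟩
    rw [RingHom.mem_ker, map_sub, map_one, sub_eq_zero] at this
    exact this

/-- The critical locus of a projective family of complete intersections is defined by the equations
and the minors of the Jacobian matrix with respect to the homogeneous coordinates. -/
theorem ker_critι {r : ℕ} {F : Fin r → MvPolynomial (Fin k) A} {p : Fin r → ℕ}
    (hF : ∀ j, (F j).IsHomogeneous (p j)) :
    (critι (Ideal.span (Set.range F)) ((k : ℤ) - 1 - r)).ker = projIdeal (critEquations F) := by
  refine Scheme.IdealSheafData.ext_of_iSup_eq_top
    (fun i : Fin k => linOpen (X i : MvPolynomial (Fin k) A) (X_mem_one i)) iSup_linOpen_X fun i => ?_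
  have hX := X_mem_one (A := A) i
  have hJ := isHomogeneous_span_range hF
  rw [projIdeal_ideal (isHomogeneous_critEquations hF)]
  refine (ker_subschemeι_comp_ideal (projSubschemeι (Ideal.span (Set.range F))) _ _).trans ?_
  -- Pulling the ideal of minors back to the ambient chart adds the kernel of restriction, that is,
  -- the equations F.
  rw [criticalIdeal_projSubscheme hF i, ← Ideal.map_map,
    Ideal.comap_map_of_surjective' _ ((projSubschemeι _).app_surjective _ (linOpen (X i) hX).2)]
  have h2 := Scheme.Hom.ker_apply (projSubschemeι (Ideal.span (Set.range F))) (linOpen (X i) hX)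
  rw [ker_projSubschemeι, projIdeal_ideal hJ] at h2
  rw [← h2, Ideal.map_sup, sup_comm]

end CriticalEquations

/-! ### Points of closed subschemes as primes of the polynomial ring. -/

section Points

theorem basicOpen_inf_eq_basicOpen_awayToSection {σ : Type*} {B : Type u} [CommRing B]
    [SetLike σ B] [AddSubgroupClass σ B] (𝒜 : ℕ → σ) [GradedRing 𝒜] {f g : B} {m n : ℕ}
    (hf : f ∈ 𝒜 m) (hm : 0 < m) (hg : g ∈ 𝒜 n) (hn : 0 < n) :
    Proj.basicOpen 𝒜 f ⊓ Proj.basicOpen 𝒜 g =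
      (Proj 𝒜).basicOpen (Proj.awayToSection 𝒜 f
        (HomogeneousLocalization.Away.isLocalizationElem hf hg)) := by
  have key : Proj.awayι 𝒜 f hf hm ⁻¹ᵁ Proj.basicOpen 𝒜 g = Proj.awayι 𝒜 f hf hm ⁻¹ᵁ
      (Proj 𝒜).basicOpen (Proj.awayToSection 𝒜 f
        (HomogeneousLocalization.Away.isLocalizationElem hf hg)) := by
    have hp := (awayι_preimage_basicOpen_self 𝒜 f hf hm).ge
    have h1 := Scheme.basicOpen_appLE (Proj.awayι 𝒜 f hf hm) ⊤ (Proj.basicOpen 𝒜 f) hp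
      (Proj.awayToSection 𝒜 f (HomogeneousLocalization.Away.isLocalizationElem hf hg))
    rw [top_inf_eq, ← CommRingCat.comp_apply, awayToSection_awayι_appLE] at h1
    rw [← h1, Proj.awayι_preimage_basicOpen 𝒜 hf hm hg hn]
    exact (basicOpen_eq_of_affine (R := CommRingCat.of (HomogeneousLocalization.Away 𝒜 f)) _).symm
  refine le_antisymm ?_ (le_inf ((Proj 𝒜).basicOpen_le _) ?_)
  · rintro x ⟨hx, hx'⟩
    rw [SetLike.mem_coe, ← Proj.opensRange_awayι 𝒜 f hf hm] at hx
    obtain ⟨y, rfl⟩ := hx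
    exact key.le hx'
  · intro x hx
    have hx' := (Proj 𝒜).basicOpen_le _ hx
    rw [← Proj.opensRange_awayι 𝒜 f hf hm] at hx'
    obtain ⟨y, rfl⟩ := hx'
    exact key.ge hx

theorem mem_basicOpen_algebraMap {A : Type u} [CommRing A] {Z : Scheme.{u}}
    (π : Z ⟶ Spec (CommRingCat.of A)) (U : Z.Opens) {z : Z} (hz : z ∈ U) (a : A) :
    z ∈ Z.basicOpen ((sectionsAlgebra π U).algebraMap a) ↔ a ∉ (π z).asIdeal := by
  have h1 : Z.basicOpen ((sectionsAlgebra π U).algebraMap a) =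
      U ⊓ π ⁻¹ᵁ (Spec (CommRingCat.of A)).basicOpen
        ((Scheme.ΓSpecIso (CommRingCat.of A)).inv a) := by
    rw [Scheme.preimage_basicOpen_top]
    exact Z.basicOpen_res _ _
  have h2 : (Spec (CommRingCat.of A)).basicOpen ((Scheme.ΓSpecIso (CommRingCat.of A)).inv a) =
      PrimeSpectrum.basicOpen a := basicOpen_eq_of_affine (R := CommRingCat.of A) a
  rw [h1, h2]
  exact ⟨fun h => h.2, fun h => ⟨hz, h⟩⟩

variable {A : Type u} [CommRing A] {k : ℕ}

theorem linOpen_inf_linOpen {L L' : MvPolynomial (Fin k) A}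
    (hL : L ∈ homogeneousSubmodule (Fin k) A 1) (hL' : L' ∈ homogeneousSubmodule (Fin k) A 1) :
    (linOpen L hL).1 ⊓ (linOpen L' hL').1 = (projSpace A k).basicOpen (linSec L hL L') := by
  refine (basicOpen_inf_eq_basicOpen_awayToSection (homogeneousSubmodule (Fin k) A) hL one_pos
    hL' one_pos).trans ?_
  have h : awayDehom L hL L' = HomogeneousLocalization.Away.isLocalizationElem hL hL' := by
    rw [awayDehom_eq_mk hL (n := 1) (by simpa using hL')]
    simp [HomogeneousLocalization.Away.isLocalizationElem]
  change _ = (projSpace A k).basicOpen (awaySec L hL (awayDehom L hL L'))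
  rw [h]
  rfl

variable {Z : Scheme.{u}} (ι : Z ⟶ projSpace A k)

/-- The ring homomorphism underlying `schemeSec`. -/
def secHom (L : MvPolynomial (Fin k) A) (hL : L ∈ homogeneousSubmodule (Fin k) A 1) :
    MvPolynomial (Fin k) A →+* Γ(Z, ι ⁻¹ᵁ (linOpen L hL).1) :=
  (ι.app (linOpen L hL).1).hom.comp (linSec L hL)

theorem secHom_surjective [IsClosedImmersion ι] {L : MvPolynomial (Fin k) A}
    (hL : L ∈ homogeneousSubmodule (Fin k) A 1) : Function.Surjective (secHom ι L hL) :=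
  schemeSec_surjective ι L hL

theorem ker_secHom [IsClosedImmersion ι] {J : Ideal (MvPolynomial (Fin k) A)}
    (hJ : J.IsHomogeneous (homogeneousSubmodule (Fin k) A)) (hι : ι.ker = projIdeal J)
    {L : MvPolynomial (Fin k) A} (hL : L ∈ homogeneousSubmodule (Fin k) A 1) :
    RingHom.ker (secHom ι L hL) = Ideal.span {L - 1} ⊔ J :=
  ker_schemeSec ι L hL hJ hι

theorem algebraMap_sections_eq_secHom (L : MvPolynomial (Fin k) A)
    (hL : L ∈ homogeneousSubmodule (Fin k) A 1) (a : A) :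
    (sectionsAlgebra (ι ≫ projSpaceToSpec A k) (ι ⁻¹ᵁ (linOpen L hL).1)).algebraMap a =
      secHom ι L hL (C a) :=
  algebraMap_sections_eq ι L hL a

theorem preimage_linOpen_inf {L L' : MvPolynomial (Fin k) A}
    (hL : L ∈ homogeneousSubmodule (Fin k) A 1) (hL' : L' ∈ homogeneousSubmodule (Fin k) A 1) :
    ι ⁻¹ᵁ (linOpen L hL).1 ⊓ ι ⁻¹ᵁ (linOpen L' hL').1 = Z.basicOpen (secHom ι L hL L') := by
  have h := congrArg (fun U => ι ⁻¹ᵁ U) (linOpen_inf_linOpen hL hL')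
  refine Eq.trans ?_ (h.trans (Scheme.preimage_basicOpen ι _))
  rfl

/-- The prime ideal of the point `z` of the chart `L ≠ 0`. -/
theorem exists_prime_of_point {L : MvPolynomial (Fin k) A}
    (hL : L ∈ homogeneousSubmodule (Fin k) A 1) {z : Z} (hz : z ∈ ι ⁻¹ᵁ (linOpen L hL).1) :
    ∃ P : Ideal (MvPolynomial (Fin k) A), P.IsPrime ∧ RingHom.ker (secHom ι L hL) ≤ P ∧
      P.comap C = ((ι ≫ projSpaceToSpec A k) z).asIdeal ∧
      ∀ (L' : MvPolynomial (Fin k) A) (hL' : L' ∈ homogeneousSubmodule (Fin k) A 1),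
        L' ∈ P ↔ z ∉ ι ⁻¹ᵁ (linOpen L' hL').1 := by
  let γ := (Z.presheaf.germ (ι ⁻¹ᵁ (linOpen L hL).1) z hz).hom
  let P := ((IsLocalRing.maximalIdeal (Z.presheaf.stalk z)).comap γ).comap
    (secHom ι L hL)
  have hP : ∀ b, b ∈ P ↔ z ∉ Z.basicOpen (secHom ι L hL b) := fun b => by
    rw [Scheme.mem_basicOpen _ _ _ hz]; rfl
  refine ⟨P, inferInstance, fun b hb => ?_, ?_, fun L' hL' => ?_⟩
  · have : secHom ι L hL b = 0 := hb
    rw [hP, this, Scheme.basicOpen_zero]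
    exact id
  · ext a
    rw [Ideal.mem_comap, hP, ← not_iff_not, not_not,
      ← mem_basicOpen_algebraMap (ι ≫ projSpaceToSpec A k) _ hz]
    rw [algebraMap_sections_eq_secHom]
  · rw [hP, ← preimage_linOpen_inf ι hL hL']
    exact not_congr ⟨fun h => h.2, fun h => ⟨hz, h⟩⟩

/-- Converse to the passage from points to primes. Encoding points by primes of A[y] allows them to
be carried along a change of the base ring. -/
theorem exists_point_of_prime [IsClosedImmersion ι] {L : MvPolynomial (Fin k) A}
    (hL : L ∈ homogeneousSubmodule (Fin k) A 1) (P : Ideal (MvPolynomial (Fin k) A)) [P.IsPrime]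
    (hP : RingHom.ker (secHom ι L hL) ≤ P) :
    ∃ z : Z, ((ι ≫ projSpaceToSpec A k) z).asIdeal = P.comap C ∧
      ∀ (L' : MvPolynomial (Fin k) A) (hL' : L' ∈ homogeneousSubmodule (Fin k) A 1),
        L' ∈ P → z ∉ ι ⁻¹ᵁ (linOpen L' hL').1 := by
  have hs := secHom_surjective ι hL
  have hU : IsAffineOpen (ι ⁻¹ᵁ (linOpen L hL).1) := (linOpen L hL).2.preimage ι
  have hprime : (P.map (secHom ι L hL)).IsPrime := Ideal.map_isPrime_of_surjective hs hP
  have hmem : ∀ b, secHom ι L hL b ∈ P.map (secHom ι L hL) ↔ b ∈ P := fun b => by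
    have := Ideal.comap_map_of_surjective' (secHom ι L hL) hs P
    rw [sup_eq_left.2 hP] at this
    exact SetLike.ext_iff.1 this b
  let q : Spec Γ(Z, ι ⁻¹ᵁ (linOpen L hL).1) := ⟨P.map (secHom ι L hL), hprime⟩
  have hz : hU.fromSpec q ∈ ι ⁻¹ᵁ (linOpen L hL).1 := by
    have : hU.fromSpec q ∈ Set.range hU.fromSpec := ⟨q, rfl⟩
    rwa [hU.range_fromSpec] at this
  have hq : ∀ b, hU.fromSpec q ∈ Z.basicOpen (secHom ι L hL b) ↔ b ∉ P := fun b => by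
    rw [← hmem]
    exact SetLike.ext_iff.1 (hU.fromSpec_preimage_basicOpen (secHom ι L hL b)) q
  refine ⟨hU.fromSpec q, ?_, fun L' hL' h h' => ?_⟩
  · ext a
    rw [Ideal.mem_comap, ← not_iff_not, ← hq,
      ← mem_basicOpen_algebraMap (ι ≫ projSpaceToSpec A k) _ hz]
    rw [algebraMap_sections_eq_secHom]
  · refine (hq L').1 ?_ h
    rw [← preimage_linOpen_inf ι hL hL']
    exact ⟨hz, h'⟩

end Points

/-! ### Avoiding a hyperplane, and finiteness. -/

section LinearForms

variable {A : Type u} [CommRing A] {k : ℕ}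

/-- The linear form with the given coefficients. -/
def linForm (c : Fin k → A) : MvPolynomial (Fin k) A := ∑ i, C (c i) * X i

theorem linForm_mem (c : Fin k → A) : linForm c ∈ homogeneousSubmodule (Fin k) A 1 :=
  Submodule.sum_mem _ fun i _ => by
    rw [← smul_eq_C_mul]; exact Submodule.smul_mem _ _ (X_mem_one i)

theorem map_linForm {B : Type*} [CommRing B] (φ : A →+* B) (c : Fin k → A) :
    map φ (linForm c) = linForm (φ ∘ c) := by
  simp [linForm]

variable {Z : Scheme.{u}} (ι : Z ⟶ projSpace A k)

theorem exists_mem_chart (z : Z) :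
    ∃ i : Fin k, z ∈ ι ⁻¹ᵁ (linOpen (X i : MvPolynomial (Fin k) A) (X_mem_one i)).1 := by
  have h : ι z ∈ ⨆ i : Fin k, (linOpen (X i : MvPolynomial (Fin k) A) (X_mem_one i)).1 := by
    rw [iSup_linOpen_X]; trivial
  obtain ⟨i, hi⟩ := TopologicalSpace.Opens.mem_iSup.1 h
  exact ⟨i, hi⟩

/-- The linear forms over K vanishing at a given point form a proper subspace, since some coordinate
is nonzero there, and a vector space over an infinite field is not a finite union of proper
subspaces. -/
theorem exists_linForm_ne_zero {K : Type v} [Field K] [Infinite K] [Algebra K A] (T : Set Z)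
    (hT : T.Finite) : ∃ c : Fin k → K, ∀ z ∈ T,
      z ∈ ι ⁻¹ᵁ (linOpen (linForm (algebraMap K A ∘ c)) (linForm_mem _)).1 := by
  choose i hi using exists_mem_chart ι
  choose P hP _ _ hPL using fun z => exists_prime_of_point ι _ (hi z)
  let lin : (Fin k → K) →ₗ[K] MvPolynomial (Fin k) A :=
    Fintype.linearCombination K fun i => (X i : MvPolynomial (Fin k) A)
  have hlin : ∀ c, lin c = linForm (algebraMap K A ∘ c) := fun c => by
    simp only [lin, linForm, Fintype.linearCombination_apply, Function.comp_apply]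
    refine Finset.sum_congr rfl fun i _ => ?_
    rw [← smul_eq_C_mul, algebraMap_smul]
  let V : T → Subspace K (Fin k → K) := fun z => ((P z).restrictScalars K).comap lin
  have hV : ∀ z, V z ≠ ⊤ := fun z h => by
    have h1 : Pi.single (i z) (1 : K) ∈ V z := h ▸ Submodule.mem_top
    have h2 : lin (Pi.single (i z) 1) ∈ P z := h1
    rw [Fintype.linearCombination_apply_single, one_smul] at h2
    exact (hPL z _ (X_mem_one _)).1 h2 (hi z)
  have := hT.to_subtype
  have hne : ⋃ z, (V z : Set (Fin k → K)) ≠ Set.univ := fun h =>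
    (Subspace.exists_eq_top_of_iUnion_eq_univ h).elim fun z hz => hV z hz
  obtain ⟨c, hc⟩ := (Set.ne_univ_iff_exists_notMem _).1 hne
  refine ⟨c, fun z hz => ?_⟩
  by_contra h
  refine hc (Set.mem_iUnion.2 ⟨⟨z, hz⟩, ?_⟩)
  change lin c ∈ P z
  rw [hlin]
  exact (hPL z _ (linForm_mem _)).2 h

/-- Over a local ring, a finite closed subscheme of the projective space avoids a hyperplane. -/
theorem exists_linForm_preimage_eq_top {K : Type v} [Field K] [Infinite K] [Algebra K A]
    [IsLocalRing A] [IsFinite (ι ≫ projSpaceToSpec A k)] : ∃ c : Fin k → K,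
      ι ⁻¹ᵁ (linOpen (linForm (algebraMap K A ∘ c)) (linForm_mem _)).1 = ⊤ := by
  let π := ι ≫ projSpaceToSpec A k
  obtain ⟨c, hc⟩ := exists_linForm_ne_zero (K := K) ι (π ⁻¹' {IsLocalRing.closedPoint A})
    (π.finite_preimage_singleton _)
  refine ⟨c, ?_⟩
  by_contra hne
  let W := ι ⁻¹ᵁ (linOpen (linForm (algebraMap K A ∘ c)) (linForm_mem _)).1
  obtain ⟨z, hz⟩ : ∃ z, z ∉ W := by
    by_contra! h
    exact hne (eq_top_iff.2 fun z _ => h z)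
  -- The image of the points on the hyperplane is closed; if nonempty, it contains the closed point,
  -- over which there is no such point.
  have hcl : IsClosed (π '' (W : Set Z)ᶜ) := π.isClosedMap _ W.2.isClosed_compl
  have hsp : π z ⤳ IsLocalRing.closedPoint A := IsLocalRing.specializes_closedPoint _
  obtain ⟨z', hz', hπ⟩ := hsp.mem_closed hcl ⟨z, hz, rfl⟩
  exact hz' (hc z' hπ)

/-- The image in the base of the points with L = 0 is closed by properness and misses s, so a
principal neighbourhood of s misses it. -/
theorem exists_basicOpen_le {L : MvPolynomial (Fin k) A}
    (hL : L ∈ homogeneousSubmodule (Fin k) A 1) [IsClosedImmersion ι] (s : PrimeSpectrum A)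
    (hs : ∀ z, (ι ≫ projSpaceToSpec A k) z = s → z ∈ ι ⁻¹ᵁ (linOpen L hL).1) :
    ∃ h ∉ s.asIdeal, ∀ z, h ∉ ((ι ≫ projSpaceToSpec A k) z).asIdeal →
      z ∈ ι ⁻¹ᵁ (linOpen L hL).1 := by
  let π := ι ≫ projSpaceToSpec A k
  have hcl : IsClosed (π '' (ι ⁻¹ᵁ (linOpen L hL).1 : Set Z)ᶜ) :=
    π.isClosedMap _ (ι ⁻¹ᵁ (linOpen L hL).1).2.isClosed_compl
  have hs' : s ∈ (π '' (ι ⁻¹ᵁ (linOpen L hL).1 : Set Z)ᶜ)ᶜ := by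
    rintro ⟨z, hz, hzs⟩
    exact hz (hs z hzs)
  obtain ⟨_, ⟨h, rfl⟩, hsh, hh⟩ := PrimeSpectrum.isTopologicalBasis_basic_opens.exists_subset_of_mem_open
    hs' hcl.isOpen_compl
  refine ⟨h, hsh, fun z hz => ?_⟩
  by_contra hzW
  exact hh (show π z ∈ _ from hz) ⟨z, hzW, rfl⟩

/-- The part of Z over h ≠ 0 is a principal open subset of the affine chart L ≠ 0, hence affine, and
proper with affine source over an affine base means finite. -/
theorem isFiniteAt_of_forall_mem {L : MvPolynomial (Fin k) A}
    (hL : L ∈ homogeneousSubmodule (Fin k) A 1) [IsClosedImmersion ι] {s : PrimeSpectrum A} {h : A}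
    (hs : h ∉ s.asIdeal)
    (hh : ∀ z, h ∉ ((ι ≫ projSpaceToSpec A k) z).asIdeal → z ∈ ι ⁻¹ᵁ (linOpen L hL).1) :
    IsFiniteAt (ι ≫ projSpaceToSpec A k) s := by
  let π := ι ≫ projSpaceToSpec A k
  have : IsProper π := inferInstanceAs (IsProper (ι ≫ projSpaceToSpec A k))
  let U : (Spec (CommRingCat.of A)).Opens := PrimeSpectrum.basicOpen h
  have hU : IsAffineOpen U := IsAffineOpen.Spec_basicOpen (R := CommRingCat.of A) h
  refine ⟨U, hs, ?_⟩
  have hW : IsAffineOpen (ι ⁻¹ᵁ (linOpen L hL).1) := (linOpen L hL).2.preimage ι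
  have hV : IsAffineOpen (π ⁻¹ᵁ U) := by
    have : π ⁻¹ᵁ U =
        Z.basicOpen ((sectionsAlgebra π (ι ⁻¹ᵁ (linOpen L hL).1)).algebraMap h) := by
      ext z
      constructor
      · intro hz
        exact (mem_basicOpen_algebraMap π _ (hh z hz) h).2 hz
      · intro hz
        exact (mem_basicOpen_algebraMap π _ (Z.basicOpen_le _ hz) h).1 hz
    rw [this]
    exact hW.basicOpen _
  have : IsAffine U := hU
  have : IsAffine (π ⁻¹ᵁ U) := hV
  exact IsFinite.iff_isProper_and_isAffineHom.2
    ⟨inferInstanceAs (IsProper (π ∣_ U)), inferInstance⟩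

end LinearForms

/-! ### Lifting points of fibres along a change of base. -/

section BaseChange

/-- The tensor product of two domains over a common subring is nonzero; Ω is a residue field of it.
The maps to Ω need not be injective. -/
theorem exists_field_of_injective {S₀ : Type*} {B₁ : Type u} {B₂ : Type v} [CommRing S₀] [CommRing B₁] [CommRing B₂]
    [IsDomain B₁] [IsDomain B₂] {α : S₀ →+* B₁} {β : S₀ →+* B₂} (hα : Function.Injective α)
    (hβ : Function.Injective β) :
    ∃ (Ω : Type (max u v)) (_ : Field Ω) (i₁ : B₁ →+* Ω) (i₂ : B₂ →+* Ω), i₁.comp α = i₂.comp β := by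
  algebraize [α, β]
  have := Algebra.TensorProduct.nontrivial_of_algebraMap_injective_of_isDomain S₀ B₁ B₂ hα hβ
  obtain ⟨N, hN⟩ := Ideal.exists_maximal (TensorProduct S₀ B₁ B₂)
  refine ⟨TensorProduct S₀ B₁ B₂ ⧸ N, Ideal.Quotient.field N,
    (Ideal.Quotient.mk N).comp Algebra.TensorProduct.includeLeftRingHom,
    (Ideal.Quotient.mk N).comp
      (Algebra.TensorProduct.includeRight (R := S₀) (A := B₁) (B := B₂)).toRingHom, ?_⟩
  rw [RingHom.comp_assoc, RingHom.comp_assoc]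
  exact congrArg _ Algebra.TensorProduct.includeLeftRingHom_comp_algebraMap

/-- A point of affine space over S above the image of m is lifted to one over A above m, by
evaluating in a field receiving both residue rings. Only A/m must embed, and it does, being a field;
on the side of P an inclusion is enough, because the conditions to be transported are closed. -/
theorem exists_prime_map_le {S : Type v} {A : Type u} [CommRing S] [CommRing A] {σ : Type*}
    (φ : S →+* A) (m : Ideal A) [m.IsMaximal] (P : Ideal (MvPolynomial σ S)) [P.IsPrime]
    (hP : P.comap C = m.comap φ) :
    ∃ P' : Ideal (MvPolynomial σ A), P'.IsPrime ∧ P'.comap C = m ∧ P.map (map φ) ≤ P' := by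
  obtain ⟨Ω, _, i₁, i₂, h⟩ := exists_field_of_injective
    (α := Ideal.quotientMap P C (le_refl (P.comap C))) (β := Ideal.quotientMap m φ hP.le)
    (Ideal.quotientMap_injective' le_rfl) (Ideal.quotientMap_injective' hP.ge)
  have hi : ∀ a : S, i₁ (Ideal.Quotient.mk P (C a)) = i₂ (Ideal.Quotient.mk m (φ a)) := fun a =>
    RingHom.congr_fun h (Ideal.Quotient.mk _ a)
  let : Field (A ⧸ m) := Ideal.Quotient.field m
  let ψ : MvPolynomial σ A →+* Ω :=
    eval₂Hom (i₂.comp (Ideal.Quotient.mk m)) fun i => i₁ (Ideal.Quotient.mk P (X i))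
  refine ⟨RingHom.ker ψ, RingHom.ker_isPrime ψ, ?_, ?_⟩
  · ext a
    rw [Ideal.mem_comap, RingHom.mem_ker, coe_eval₂Hom, eval₂_C, RingHom.comp_apply,
      map_eq_zero_iff _ (RingHom.injective _), Ideal.Quotient.eq_zero_iff_mem]
  · have hψ : ψ.comp (map φ) = i₁.comp (Ideal.Quotient.mk P) := by
      refine MvPolynomial.ringHom_ext (fun a => ?_) fun i => ?_
      · simp [ψ, hi]
      · simp [ψ]
    rw [Ideal.map_le_iff_le_comap]
    intro b hb
    rw [Ideal.mem_comap, RingHom.mem_ker, ← RingHom.comp_apply, hψ]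
    simp only [RingHom.comp_apply, Ideal.Quotient.eq_zero_iff_mem.2 hb, map_zero]

variable {S : Type v} {A : Type u} [CommRing S] [CommRing A] {k : ℕ} (φ : S →+* A)
  {Z : Scheme.{v}} (ι : Z ⟶ projSpace S k) [IsClosedImmersion ι]
  {Z' : Scheme.{u}} (ι' : Z' ⟶ projSpace A k) [IsClosedImmersion ι']

/-- A point of Z over the image of m with L = 0 would satisfy the equations J, y_i - 1 and L; its
lift is a point of Z' over m on the hyperplane φ(L) = 0. -/
theorem mem_preimage_linOpen_of_map {J : Ideal (MvPolynomial (Fin k) S)}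
    (hJ : J.IsHomogeneous (homogeneousSubmodule (Fin k) S)) (hι : ι.ker = projIdeal J)
    (hJ' : (J.map (map φ)).IsHomogeneous (homogeneousSubmodule (Fin k) A))
    (hι' : ι'.ker = projIdeal (J.map (map φ)))
    {L : MvPolynomial (Fin k) S} (hL : L ∈ homogeneousSubmodule (Fin k) S 1)
    (hL' : map φ L ∈ homogeneousSubmodule (Fin k) A 1) (m : Ideal A) [m.IsMaximal]
    (h : ∀ z, ((ι' ≫ projSpaceToSpec A k) z).asIdeal = m →
      z ∈ ι' ⁻¹ᵁ (linOpen (map φ L) hL').1) (z : Z)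
    (hz : ((ι ≫ projSpaceToSpec S k) z).asIdeal = m.comap φ) :
    z ∈ ι ⁻¹ᵁ (linOpen L hL).1 := by
  by_contra hzL
  obtain ⟨i, hi⟩ := exists_mem_chart ι z
  obtain ⟨P, hP, hker, hC, hPL⟩ := exists_prime_of_point ι _ hi
  obtain ⟨P', hP', hC', hle⟩ := exists_prime_map_le φ m P (hC.trans hz)
  rw [ker_secHom ι hJ hι] at hker
  have hker' : RingHom.ker (secHom ι' (X i) (X_mem_one i)) ≤ P' := by
    rw [ker_secHom ι' hJ' hι']
    refine le_trans (le_of_eq ?_) ((Ideal.map_mono hker).trans hle)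
    rw [Ideal.map_sup, Ideal.map_span, Set.image_singleton, map_sub, map_X, map_one]
  obtain ⟨z', hz', hzL'⟩ := exists_point_of_prime ι' (X_mem_one i) P' hker'
  exact hzL' _ hL' (hle (Ideal.mem_map_of_mem _ ((hPL L hL).2 hzL))) (h z' (hz'.trans hC'))

end BaseChange

/-! ### Localization of Fitting ideals and schematic closure. -/

section LocalFitting

open scoped TensorProduct

theorem fittingIdeal_congr {A : Type*} [CommRing A] {M M' : Type*} [AddCommGroup M] [Module A M]
    [AddCommGroup M'] [Module A M'] [Module.Finite A M] (e : M ≃ₗ[A] M') (j : ℤ) :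
    fittingIdeal A M' j = fittingIdeal A M j := by
  have h := fittingIdeal_baseChange (B := A) e.toLinearMap (IsBaseChange.ofEquiv e) j
  rwa [Algebra.algebraMap_self, Ideal.map_id] at h

variable {S : Type u} [CommRing S] (M : Type v) [AddCommGroup M] [Module S M]

/-- The elements of `S` whose image in the localization at `T` belongs to the initial Fitting ideal
of the localization of `M`. -/
def localFitting (T : Submonoid S) : Ideal S :=
  (fittingIdeal (Localization T) (LocalizedModule T M) 0).comap (algebraMap S (Localization T))

variable {T T' : Submonoid S} (h : T ≤ T')

include h in
theorem exists_isBaseChange_localizedModule :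
    letI := IsLocalization.localizationAlgebraOfSubmonoidLe (Localization T) (Localization T') T T' h
    ∃ (_ : Module (Localization T) (LocalizedModule T' M))
      (_ : IsScalarTower (Localization T) (Localization T') (LocalizedModule T' M))
      (f : LocalizedModule T M →ₗ[Localization T] LocalizedModule T' M),
      IsBaseChange (Localization T') f := by
  let := IsLocalization.localizationAlgebraOfSubmonoidLe (Localization T) (Localization T') T T' h
  have := IsLocalization.localization_isScalarTower_of_submonoid_le (Localization T)
    (Localization T') T T' h
  let : Module (Localization T) (LocalizedModule T' M) :=
    Module.compHom _ (algebraMap (Localization T) (Localization T'))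
  have i1 : IsScalarTower (Localization T) (Localization T') (LocalizedModule T' M) :=
    IsScalarTower.of_algebraMap_smul fun _ _ => rfl
  have : IsScalarTower S (Localization T) (LocalizedModule T' M) :=
    IsScalarTower.of_algebraMap_smul fun a x => by
      rw [← algebraMap_smul (Localization T'), ← IsScalarTower.algebraMap_apply, algebraMap_smul]
  have h1 := IsLocalizedModule.isBaseChange T (Localization T) (LocalizedModule.mkLinearMap T M)
  have h2 := IsLocalizedModule.isBaseChange T' (Localization T') (LocalizedModule.mkLinearMap T' M)
  refine ⟨inferInstance, i1, h1.lift (LocalizedModule.mkLinearMap T' M), h1.of_comp ?_⟩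
  rwa [h1.lift_comp]

include h in
theorem finite_localizedModule_of_le [Module.Finite (Localization T) (LocalizedModule T M)] :
    Module.Finite (Localization T') (LocalizedModule T' M) := by
  let := IsLocalization.localizationAlgebraOfSubmonoidLe (Localization T) (Localization T') T T' h
  obtain ⟨_, _, f, hf⟩ := exists_isBaseChange_localizedModule M h
  exact Module.Finite.equiv hf.equiv

include h in
-- The module at T' is a base change of the finite module at T, so its Fitting ideal is the
-- extension of the one at T, and membership is tested after clearing a denominator from T'.
theorem mem_localFitting_iff [Module.Finite (Localization T) (LocalizedModule T M)] (a : S) :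
    a ∈ localFitting M T' ↔ ∃ u ∈ T', u * a ∈ localFitting M T := by
  let := IsLocalization.localizationAlgebraOfSubmonoidLe (Localization T) (Localization T') T T' h
  have := IsLocalization.localization_isScalarTower_of_submonoid_le (Localization T)
    (Localization T') T T' h
  have := IsLocalization.isLocalization_of_submonoid_le (Localization T) (Localization T') T T' h
  obtain ⟨_, _, f, hf⟩ := exists_isBaseChange_localizedModule M h
  rw [localFitting, fittingIdeal_baseChange f hf, Ideal.mem_comap,
    IsScalarTower.algebraMap_apply S (Localization T) (Localization T'),
    IsLocalization.algebraMap_mem_map_algebraMap_iff (T'.map (algebraMap S (Localization T)))]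
  constructor
  · rintro ⟨_, ⟨u, hu, rfl⟩, hm⟩
    exact ⟨u, hu, by rwa [localFitting, Ideal.mem_comap, map_mul]⟩
  · rintro ⟨u, hu, hm⟩
    exact ⟨_, ⟨u, hu, rfl⟩, by rwa [localFitting, Ideal.mem_comap, map_mul] at hm⟩

variable {M} in
theorem mem_localFitting_of_mul_mem [Module.Finite (Localization T) (LocalizedModule T M)] {a u : S}
    (hu : u ∈ T) (ha : u * a ∈ localFitting M T) : a ∈ localFitting M T :=
  (mem_localFitting_iff M le_rfl a).2 ⟨u, hu, ha⟩

variable {M} in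
include h in
theorem localFitting_mono [Module.Finite (Localization T) (LocalizedModule T M)] :
    localFitting M T ≤ localFitting M T' := fun a ha =>
  (mem_localFitting_iff M h a).2 ⟨1, T'.one_mem, by rwa [one_mul]⟩

/-- A scheme-theoretic closure is compatible with localization: over a noetherian base, the functions
that lie in the Fitting ideal at all points of a quasi-compact open set generate this ideal. -/
theorem map_iInf_localFitting [IsNoetherianRing S] (V : Set (PrimeSpectrum S))
    (hV : ∀ t ∈ V, ∃ w ∉ t.asIdeal,
      Module.Finite (Localization (Submonoid.powers w)) (LocalizedModule (Submonoid.powers w) M))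
    {s : PrimeSpectrum S} (hs : s ∈ V) :
    (⨅ t ∈ V, localFitting M t.asIdeal.primeCompl).map
        (algebraMap S (Localization.AtPrime s.asIdeal)) =
      fittingIdeal (Localization.AtPrime s.asIdeal)
        (LocalizedModule s.asIdeal.primeCompl M) 0 := by
  have hle : ∀ {t : PrimeSpectrum S} {w : S}, w ∉ t.asIdeal →
      Submonoid.powers w ≤ t.asIdeal.primeCompl := fun hw => by
    rw [Submonoid.powers_le]; exact hw
  refine le_antisymm (Ideal.map_le_iff_le_comap.2 (iInf₂_le s hs)) fun x hx => ?_
  -- The open sets on which the module is finite: by noetherianity finitely many elements of `W`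
  -- already cover their union.
  let W : Set S := {w | Module.Finite (Localization (Submonoid.powers w))
    (LocalizedModule (Submonoid.powers w) M)}
  obtain ⟨W', hW', hspan⟩ := (Submodule.fg_span_iff_fg_span_finset_subset W).1
    (IsNoetherian.noetherian (Ideal.span W))
  obtain ⟨h, hhs, hfin⟩ := hV s hs
  obtain ⟨y, u, hu⟩ := IsLocalization.exists_mk'_eq s.asIdeal.primeCompl x
  have hy : y ∈ localFitting M s.asIdeal.primeCompl := by
    rw [localFitting, Ideal.mem_comap, ← IsLocalization.mk'_spec _ y u, hu]
    exact Ideal.mul_mem_right _ _ hx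
  obtain ⟨v, hv, hvy⟩ := (mem_localFitting_iff M (hle hhs) y).1 hy
  -- `v * y` lies in the Fitting ideal over D(h), hence over D(hw); clearing a power of h brings it
  -- into the Fitting ideal over D(w). One exponent `N` then serves the finite cover, and h is a
  -- unit at s.
  have key : ∀ w ∈ W, ∃ n : ℕ, h ^ n * (v * y) ∈ localFitting M (Submonoid.powers w) := by
    intro w hw
    have : Module.Finite _ _ := hw
    have h1 := localFitting_mono (le_sup_left (b := Submonoid.powers w)) hvy
    obtain ⟨_, hz, h2⟩ := (mem_localFitting_iff M (le_sup_right (a := Submonoid.powers h)) _).1 h1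
    obtain ⟨_, ⟨n, rfl⟩, _, ⟨m, rfl⟩, rfl⟩ := Submonoid.mem_sup.1 hz
    refine ⟨n, mem_localFitting_of_mul_mem ⟨m, rfl⟩ ?_⟩
    convert h2 using 1
    ring
  choose! n hn using key
  let N := W'.sup n
  have hmem : h ^ N * (v * y) ∈ ⨅ t ∈ V, localFitting M t.asIdeal.primeCompl := by
    simp only [Ideal.mem_iInf]
    intro t ht
    obtain ⟨w, hwt, hw⟩ := hV t ht
    obtain ⟨w', hw', hw't⟩ : ∃ w' ∈ W', w' ∉ t.asIdeal := by
      by_contra! hc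
      have : Ideal.span W ≤ t.asIdeal := by
        refine le_trans (le_of_eq hspan) (Ideal.span_le.2 hc)
      exact hwt (this (Ideal.subset_span hw))
    have : Module.Finite _ _ := hW' hw'
    refine localFitting_mono (hle hw't) ?_
    have hle' : n w' ≤ N := Finset.le_sup hw'
    rw [← Nat.sub_add_cancel hle', pow_add, mul_assoc]
    exact Ideal.mul_mem_left _ _ (hn w' (hW' hw'))
  have h3 := Ideal.mem_map_of_mem (algebraMap S (Localization.AtPrime s.asIdeal)) hmem
  have hunit : IsUnit (algebraMap S (Localization.AtPrime s.asIdeal) (h ^ N * v)) :=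
    IsLocalization.map_units _ (⟨h ^ N * v, mul_mem (pow_mem (show h ∈ s.asIdeal.primeCompl from hhs) _) hv⟩ :
      s.asIdeal.primeCompl)
  rw [← mul_assoc, map_mul, Ideal.unit_mul_mem_iff_mem _ hunit] at h3
  rw [← hu, IsLocalization.mk'_eq_mul_mk'_one]
  exact Ideal.mul_mem_right _ _ h3

/-- A linear map whose kernel and cokernel are torsion is an isomorphism after localization. -/
theorem exists_localizedModule_equiv {M : Type v} [AddCommGroup M] [Module S M] {N : Type*}
    [AddCommGroup N] [Module S N] (T : Submonoid S) (ρ : M →ₗ[S] N)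
    (hker : ∀ x, ρ x = 0 → ∃ u ∈ T, u • x = 0) (hrange : ∀ y, ∃ u ∈ T, ∃ x, ρ x = u • y) :
    Nonempty (LocalizedModule T M ≃ₗ[Localization T] LocalizedModule T N) := by
  let f := (LocalizedModule.mkLinearMap T N).comp ρ
  have : IsLocalizedModule T f := by
    refine ⟨IsLocalizedModule.map_units (LocalizedModule.mkLinearMap T N), fun y => ?_,
      fun {x x'} hx => ?_⟩
    · obtain ⟨⟨n, u⟩, hu⟩ := IsLocalizedModule.surj T (LocalizedModule.mkLinearMap T N) y
      obtain ⟨v, hv, x, hx⟩ := hrange n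
      refine ⟨⟨x, ⟨v, hv⟩ * u⟩, ?_⟩
      change _ = LocalizedModule.mkLinearMap T N (ρ x)
      rw [mul_smul, hu, hx, map_smul]
      rfl
    · obtain ⟨c, hc⟩ := IsLocalizedModule.exists_of_eq (S := T)
        (f := LocalizedModule.mkLinearMap T N) hx
      have : ρ (c • (x - x')) = 0 := by
        rw [Submonoid.smul_def, map_smul, map_sub, smul_sub, sub_eq_zero]
        exact hc
      obtain ⟨u, hu, h⟩ := hker _ this
      refine ⟨⟨u, hu⟩ * c, ?_⟩
      rw [smul_sub, smul_sub, sub_eq_zero] at h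
      rw [mul_smul, mul_smul]
      exact h
  exact ⟨(IsLocalizedModule.linearEquiv T (LocalizedModule.mkLinearMap T M) f).extendScalarsOfIsLocalization
    T (Localization T)⟩

theorem exists_isBaseChange_quotient_of_equiv {S A T B : Type*} [CommRing S] [CommRing A]
    [Algebra S A] [CommRing T] [Algebra S T] [CommRing B] [Algebra A B] [Algebra S B]
    [IsScalarTower S A B] (e : TensorProduct S A T ≃ₐ[A] B) (g : T →+* B)
    (hg : ∀ t, e (1 ⊗ₜ t) = g t) (I : Ideal T) (J : Ideal B) (hJ : J = I.map g) :
    ∃ f : (T ⧸ I) →ₗ[S] (B ⧸ J), IsBaseChange A f := by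
  have hJ' : J = (I.map (Algebra.TensorProduct.includeRight (A := A) (R := S) (B := T))).map
      (e : TensorProduct S A T →+* B) := by
    rw [hJ]
    refine le_antisymm (Ideal.map_le_iff_le_comap.2 fun t ht => ?_) (Ideal.map_le_iff_le_comap.2
      (Ideal.map_le_iff_le_comap.2 fun t ht => ?_))
    · rw [Ideal.mem_comap, ← hg]
      exact Ideal.mem_map_of_mem (e : TensorProduct S A T →+* B)
        (Ideal.mem_map_of_mem (Algebra.TensorProduct.includeRight (A := A) (R := S) (B := T)) ht)
    · have h := Ideal.mem_map_of_mem g ht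
      rw [← hg] at h
      exact h
  let e' := (Algebra.TensorProduct.tensorQuotientEquiv (R := S) A T A I).trans
    (Ideal.quotientEquivAlg _ J e hJ')
  exact ⟨(e'.toLinearMap.restrictScalars S).comp (TensorProduct.mk S A _ 1),
    IsBaseChange.of_equiv e'.toLinearEquiv fun _ => rfl⟩

/-- Base change of a quotient of a polynomial ring. -/
theorem exists_isBaseChange_quotient {S A σ : Type*} [CommRing S] [CommRing A] [Algebra S A]
    (I : Ideal (MvPolynomial σ S)) (J : Ideal (MvPolynomial σ A))
    (hJ : J = I.map (map (algebraMap S A))) :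
    ∃ f : (MvPolynomial σ S ⧸ I) →ₗ[S] (MvPolynomial σ A ⧸ J), IsBaseChange A f :=
  exists_isBaseChange_quotient_of_equiv (algebraTensorAlgEquiv (σ := σ) S A)
    (map (algebraMap S A)) (fun t => by rw [algebraTensorAlgEquiv_tmul, one_smul]) I J hJ

/-- The Fitting ideal of a localization maps to that of the base change to a local ring. -/
theorem fittingIdeal_eq_map_localization {S A : Type*} [CommRing S] [CommRing A] [Algebra S A]
    {C D : Type*} [AddCommGroup C] [Module S C] [AddCommGroup D] [Module S D] [Module A D]
    [IsScalarTower S A D] {f : C →ₗ[S] D} (hf : IsBaseChange A f) (T : Submonoid S)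
    (hT : ∀ u ∈ T, IsUnit (algebraMap S A u))
    [Module.Finite (Localization T) (LocalizedModule T C)] (I : Ideal S)
    (hI : I.map (algebraMap S (Localization T)) =
      fittingIdeal (Localization T) (LocalizedModule T C) 0) :
    I.map (algebraMap S A) = fittingIdeal A D 0 ∧ Module.Finite A D := by
  let : Algebra (Localization T) A :=
    (IsLocalization.lift (M := T) (g := algebraMap S A) fun u => hT u u.2).toAlgebra
  have : IsScalarTower S (Localization T) A :=
    IsScalarTower.of_algebraMap_eq' (IsLocalization.lift_comp _).symm
  let : Module (Localization T) D := Module.compHom _ (algebraMap (Localization T) A)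
  have : IsScalarTower (Localization T) A D := IsScalarTower.of_algebraMap_smul fun _ _ => rfl
  have : IsScalarTower S (Localization T) D :=
    IsScalarTower.of_algebraMap_smul fun a x => by
      rw [← algebraMap_smul A, ← IsScalarTower.algebraMap_apply, algebraMap_smul]
  have h1 := IsLocalizedModule.isBaseChange T (Localization T) (LocalizedModule.mkLinearMap T C)
  have h2 : IsBaseChange A (h1.lift f) := h1.of_comp (by rwa [h1.lift_comp])
  refine ⟨?_, Module.Finite.equiv h2.equiv⟩
  rw [fittingIdeal_baseChange _ h2, ← hI, Ideal.map_map, ← IsScalarTower.algebraMap_eq]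

end LocalFitting

/-! ### Global functions, restriction to a chart, and finiteness at a point. -/

section Sections

variable {A : Type u} [CommRing A] {Z : Scheme.{u}}

/-- Restriction of functions to a smaller open set. -/
def resHom {U V : Z.Opens} (h : V ≤ U) : Γ(Z, U) →+* Γ(Z, V) := (Z.presheaf.map (homOfLE h).op).hom

theorem resHom_resHom {U V W : Z.Opens} (h : V ≤ U) (h' : W ≤ V) (x : Γ(Z, U)) :
    resHom h' (resHom h x) = resHom (h'.trans h) x := by
  rw [resHom, resHom, ← CommRingCat.comp_apply, ← Functor.map_comp]
  rfl

theorem algebraMap_sectionsAlgebra_eq (π : Z ⟶ Spec (CommRingCat.of A)) {U V : Z.Opens} (h : V ≤ U)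
    (a : A) : (sectionsAlgebra π V).algebraMap a = resHom h ((sectionsAlgebra π U).algebraMap a) :=
  (resHom_resHom (le_top : U ≤ ⊤) h _).symm

/-- If `W` contains the part of `Z` over `h ≠ 0`, then the kernel and the cokernel of the restriction
of functions from `Z` to `W` are `h`-torsion. -/
theorem restriction_torsion [CompactSpace Z] [QuasiSeparatedSpace Z]
    (π : Z ⟶ Spec (CommRingCat.of A)) {W : Z.Opens} (hW : IsAffineOpen W) {h : A}
    (hh : ∀ z, h ∉ (π z).asIdeal → z ∈ W) :
    letI : Algebra A Γ(Z, ⊤) := sectionsAlgebra π ⊤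
    letI : Algebra A Γ(Z, W) := sectionsAlgebra π W
    ∃ ρ : Γ(Z, ⊤) →ₗ[A] Γ(Z, W), (∀ x, ρ x = 0 → ∃ n : ℕ, h ^ n • x = 0) ∧
      ∀ y, ∃ (n : ℕ) (x : Γ(Z, ⊤)), ρ x = h ^ n • y := by
  let : Algebra A Γ(Z, ⊤) := sectionsAlgebra π ⊤
  let : Algebra A Γ(Z, W) := sectionsAlgebra π W
  let r : Γ(Z, ⊤) →+* Γ(Z, W) := resHom le_top
  have hr : ∀ a, algebraMap A Γ(Z, W) a = r (algebraMap A Γ(Z, ⊤) a) :=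
    algebraMap_sectionsAlgebra_eq π le_top
  let a : Γ(Z, ⊤) := algebraMap A Γ(Z, ⊤) h
  have hDW : Z.basicOpen a ≤ W := fun z hz =>
    hh z ((mem_basicOpen_algebraMap π ⊤ trivial h).1 hz)
  have hD : Z.basicOpen (r a) ≤ Z.basicOpen a :=
    (Z.basicOpen_res a (homOfLE (le_top : W ≤ ⊤)).op).trans_le inf_le_right
  let ρ : Γ(Z, ⊤) →ₗ[A] Γ(Z, W) :=
    { r with
      map_smul' := fun c x => by
        change r (c • x) = c • r x
        rw [Algebra.smul_def, Algebra.smul_def, map_mul, hr] }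
  have hc : IsCompact ((⊤ : Z.Opens) : Set Z) := isCompact_univ
  have hq : IsQuasiSeparated ((⊤ : Z.Opens) : Set Z) := isQuasiSeparated_univ
  refine ⟨ρ, fun x hx => ?_, fun y => ?_⟩
  · have hx' : resHom (Z.basicOpen_le a) x = 0 := by
      rw [← resHom_resHom (le_top : W ≤ ⊤) hDW, show resHom le_top x = 0 from hx, map_zero]
    obtain ⟨n, hn⟩ := exists_pow_mul_eq_zero_of_res_basicOpen_eq_zero_of_isCompact Z hc x a hx'
    exact ⟨n, by rw [Algebra.smul_def, map_pow]; exact hn⟩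
  · obtain ⟨n, x, hx⟩ := exists_eq_pow_mul_of_isCompact_of_isQuasiSeparated Z ⊤ hc hq a
      (resHom hDW y)
    have hx' : resHom (Z.basicOpen_le a) x = resHom (Z.basicOpen_le a) a ^ n * resHom hDW y := hx
    have h0 : resHom (Z.basicOpen_le (r a)) (r x - r a ^ n * y) = 0 := by
      have h1 : resHom hDW (r x - r a ^ n * y) = 0 := by
        rw [map_sub, map_mul, map_pow, resHom_resHom, resHom_resHom, hx', sub_self]
      rw [← resHom_resHom hDW hD, h1, map_zero]
    obtain ⟨m, hm⟩ := exists_pow_mul_eq_zero_of_res_basicOpen_eq_zero_of_isCompact Z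
      hW.isCompact _ (r a) h0
    refine ⟨m + n, a ^ m * x, ?_⟩
    change r (a ^ m * x) = _
    rw [Algebra.smul_def, map_pow, hr, map_mul, map_pow, pow_add, mul_assoc]
    rwa [mul_sub, sub_eq_zero] at hm

theorem finite_localizedModule_of_isLocalizedModule {A B M N : Type*} [CommRing A] [CommRing B]
    [Algebra A B] [AddCommGroup M] [Module A M] [AddCommGroup N] [Module A N] [Module B N]
    [IsScalarTower A B N] (T : Submonoid A) [IsLocalization T B] (g : M →ₗ[A] N)
    [IsLocalizedModule T g] [Module.Finite B N] :
    Module.Finite (Localization T) (LocalizedModule T M) := by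
  let : Algebra B (Localization T) := (IsLocalization.algEquiv T B (Localization T)).toRingHom.toAlgebra
  have : IsScalarTower A B (Localization T) :=
    IsScalarTower.of_algebraMap_eq fun a =>
      ((IsLocalization.algEquiv T B (Localization T)).commutes a).symm
  let : Module B (LocalizedModule T M) := Module.compHom _ (algebraMap B (Localization T))
  have : IsScalarTower B (Localization T) (LocalizedModule T M) :=
    IsScalarTower.of_algebraMap_smul fun _ _ => rfl
  have : IsScalarTower A B (LocalizedModule T M) :=
    IsScalarTower.of_algebraMap_smul fun a x => by
      rw [← algebraMap_smul (Localization T), ← IsScalarTower.algebraMap_apply, algebraMap_smul]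
  have h1 := IsLocalizedModule.isBaseChange T B g
  have h2 := IsLocalizedModule.isBaseChange T (Localization T) (LocalizedModule.mkLinearMap T M)
  have h3 : IsBaseChange (Localization T) (h1.lift (LocalizedModule.mkLinearMap T M)) :=
    h1.of_comp (by rwa [h1.lift_comp])
  exact Module.Finite.equiv h3.equiv

theorem exists_finite_app_of_isFiniteAt (π : Z ⟶ Spec (CommRingCat.of A)) {t : PrimeSpectrum A}
    (ht : IsFiniteAt π t) : ∃ w ∉ t.asIdeal, RingHom.Finite
      (π.app ((Spec (CommRingCat.of A)).basicOpen
        ((Scheme.ΓSpecIso (CommRingCat.of A)).inv w))).hom := by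
  obtain ⟨U, htU, hU⟩ := ht
  obtain ⟨_, ⟨w, rfl⟩, htw, hw⟩ := PrimeSpectrum.isTopologicalBasis_basic_opens.exists_subset_of_mem_open
    (show t ∈ (U.1 : Set (PrimeSpectrum A)) from htU) U.2
  refine ⟨w, htw, ?_⟩
  let D := (Spec (CommRingCat.of A)).basicOpen ((Scheme.ΓSpecIso (CommRingCat.of A)).inv w)
  have hD : D = PrimeSpectrum.basicOpen w := basicOpen_eq_of_affine (R := CommRingCat.of A) w
  have hDa : IsAffineOpen D := (isAffineOpen_top _).basicOpen _
  have hDU : D ≤ U := hD.trans_le hw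
  have himg : U.ι ''ᵁ (U.ι ⁻¹ᵁ D) = D := by
    rw [Scheme.Hom.image_preimage_eq_opensRange_inf, Scheme.Opens.opensRange_ι]
    exact inf_eq_right.2 hDU
  have hV : IsAffineOpen (U.ι ⁻¹ᵁ D) := by
    rw [← Scheme.Hom.isAffineOpen_iff_of_isOpenImmersion U.ι, himg]
    exact hDa
  have hfin := (π ∣_ U).finite_app (U.ι ⁻¹ᵁ D) hV
  rw [morphismRestrict_app'] at hfin
  have key : ∀ (D' : (Spec (CommRingCat.of A)).Opens) (W : Z.Opens) (_ : D' = D)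
      (_ : W = π ⁻¹ᵁ D') (e : W ≤ π ⁻¹ᵁ D'), (π.appLE D' W e).hom.Finite →
      (π.app D).hom.Finite := by
    rintro _ _ rfl rfl e he
    rwa [Scheme.Hom.appLE_eq_app] at he
  exact key _ _ himg (image_morphismRestrict_preimage π U _) _ hfin

theorem isLocalization_away_resHom [CompactSpace Z] [QuasiSeparatedSpace Z] (b : Γ(Z, ⊤))
    {E : Z.Opens} (hE : E = Z.basicOpen b) :
    letI : Algebra Γ(Z, ⊤) Γ(Z, E) := (resHom le_top).toAlgebra
    IsLocalization.Away b Γ(Z, E) := by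
  subst hE
  exact isLocalization_basicOpen_of_qcqs isCompact_univ isQuasiSeparated_univ b

/-- As Z is quasi-compact and quasi-separated, the global functions localized at w are the functions
over D(w); near t these form a finite module. -/
theorem exists_finite_localizedModule_of_isFiniteAt [CompactSpace Z] [QuasiSeparatedSpace Z]
    (π : Z ⟶ Spec (CommRingCat.of A)) {t : PrimeSpectrum A} (ht : IsFiniteAt π t) :
    letI : Algebra A Γ(Z, ⊤) := sectionsAlgebra π ⊤
    ∃ w ∉ t.asIdeal, Module.Finite (Localization (Submonoid.powers w))
      (LocalizedModule (Submonoid.powers w) Γ(Z, ⊤)) := by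
  let : Algebra A Γ(Z, ⊤) := sectionsAlgebra π ⊤
  obtain ⟨w, hw, hfin⟩ := exists_finite_app_of_isFiniteAt π ht
  refine ⟨w, hw, ?_⟩
  let a := (Scheme.ΓSpecIso (CommRingCat.of A)).inv w
  let D := (Spec (CommRingCat.of A)).basicOpen a
  let E := π ⁻¹ᵁ D
  let ε : Γ(Spec (CommRingCat.of A), ⊤) ≃+* A :=
    (Scheme.ΓSpecIso (CommRingCat.of A)).commRingCatIsoToRingEquiv
  have hloc : IsLocalization.Away a Γ(Spec (CommRingCat.of A), D) :=
    (isAffineOpen_top _).isLocalization_basicOpen a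
  let : Algebra A Γ(Spec (CommRingCat.of A), D) :=
    ((algebraMap Γ(Spec (CommRingCat.of A), ⊤) Γ(Spec (CommRingCat.of A), D)).comp
      ε.symm.toRingHom).toAlgebra
  have h1 : IsLocalization (Submonoid.powers w) Γ(Spec (CommRingCat.of A), D) := by
    have := IsLocalization.isLocalization_of_base_ringEquiv (Submonoid.powers a)
      Γ(Spec (CommRingCat.of A), D) ε
    rw [Submonoid.map_powers] at this
    rwa [show ε a = w from ε.apply_symm_apply w] at this
  let b := algebraMap A Γ(Z, ⊤) w
  have hE : E = Z.basicOpen b := by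
    ext z
    refine Iff.trans ?_ (mem_basicOpen_algebraMap π ⊤ (z := z) trivial w).symm
    have hD : D = PrimeSpectrum.basicOpen w := basicOpen_eq_of_affine (R := CommRingCat.of A) w
    change π z ∈ D ↔ _
    rw [hD]
    rfl
  let : Algebra Γ(Z, ⊤) Γ(Z, E) := (resHom le_top).toAlgebra
  let : Algebra A Γ(Z, E) := sectionsAlgebra π E
  let : Algebra Γ(Spec (CommRingCat.of A), D) Γ(Z, E) := (π.app D).hom.toAlgebra
  have : IsScalarTower A Γ(Z, ⊤) Γ(Z, E) :=
    IsScalarTower.of_algebraMap_eq (algebraMap_sectionsAlgebra_eq π le_top)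
  have : IsScalarTower A Γ(Spec (CommRingCat.of A), D) Γ(Z, E) := by
    refine IsScalarTower.of_algebraMap_eq fun c => ?_
    have h := π.naturality (homOfLE (le_top : D ≤ ⊤)).op
    exact (congrArg (fun φ => φ.hom ((Scheme.ΓSpecIso (CommRingCat.of A)).inv c)) h).symm
  have h2 : IsLocalization.Away b Γ(Z, E) := isLocalization_away_resHom b hE
  have h3 : IsLocalizedModule (Submonoid.powers w)
      (IsScalarTower.toAlgHom A Γ(Z, ⊤) Γ(Z, E)).toLinearMap := by
    rw [isLocalizedModule_iff_isLocalization, Algebra.algebraMapSubmonoid_powers]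
    exact h2
  have : Module.Finite Γ(Spec (CommRingCat.of A), D) Γ(Z, E) := hfin
  exact finite_localizedModule_of_isLocalizedModule (Submonoid.powers w)
    (B := Γ(Spec (CommRingCat.of A), D)) (IsScalarTower.toAlgHom A Γ(Z, ⊤) Γ(Z, E)).toLinearMap

end Sections

/-! ### Specialization of the universal forms. -/

section UniversalFamily

variable {k r : ℕ} {p : Fin r → ℕ}

theorem mem_finsuppAntidiag_univ {m : Fin k →₀ ℕ} {n : ℕ} :
    m ∈ Finset.finsuppAntidiag Finset.univ n ↔ m.degree = n := by
  simp [Finset.mem_finsuppAntidiag, Finsupp.degree_eq_sum]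

theorem isHomogeneous_universalForm (K : Type v) [Field K] (j : Fin r) :
    (universalForm K k p j).IsHomogeneous (p j) :=
  IsHomogeneous.sum _ _ _ fun m _ =>
    isHomogeneous_monomial _ (mem_finsuppAntidiag_univ.1 m.2)

theorem map_universalForm (K : Type v) [Field K] {A : Type u} [CommRing A] [Algebra K A]
    {F : Fin r → MvPolynomial (Fin k) A} (hF : ∀ j, (F j).IsHomogeneous (p j)) (j : Fin r) :
    map (aeval fun c : CoeffIndex k p => coeff c.2.1 (F c.1) :
      MvPolynomial (CoeffIndex k p) K →ₐ[K] A).toRingHom (universalForm K k p j) = F j := by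
  classical
  ext d
  rw [universalForm, map_sum, coeff_sum]
  simp only [map_monomial, coeff_monomial, AlgHom.toRingHom_eq_coe, RingHom.coe_coe, aeval_X]
  by_cases hd : d ∈ Finset.finsuppAntidiag Finset.univ (p j)
  · rw [Finset.sum_eq_single ⟨d, hd⟩ (fun m _ hm => if_neg fun h => hm (Subtype.ext h))
      (fun h => absurd (Finset.mem_univ _) h), if_pos rfl]
  · rw [Finset.sum_eq_zero fun m _ => if_neg fun h : m.1 = d => hd (h ▸ m.2)]
    by_contra h
    exact hd (mem_finsuppAntidiag_univ.2 (by
      rw [Finsupp.degree_eq_weight_one]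
      exact hF j (Ne.symm h)))

/-- Partial derivatives and determinants commute with a change of coefficients, so the critical
equations of a family specialize with it. -/
theorem map_critEquations {S A : Type*} [CommRing S] [CommRing A] (φ : S →+* A)
    (G : Fin r → MvPolynomial (Fin k) S) :
    (critEquations G).map (map φ) = critEquations fun j => map φ (G j) := by
  rw [critEquations, critEquations, Ideal.map_sup, Ideal.map_span, jacobianMinors, jacobianMinors,
    Ideal.map_span, ← Set.range_comp, ← Set.range_comp]
  congr 3
  ext c
  simp only [Function.comp_apply, RingHom.map_det]
  congr 2
  ext a b
  simp [pderiv_map]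

end UniversalFamily

/-! ### Pullback of the closed Fitting image to a finite member of the family. -/

section Discriminant

variable {A : Type u} [CommRing A] {k : ℕ} {Z : Scheme.{u}} (ι : Z ⟶ projSpace A k)
  [IsClosedImmersion ι]

include ι in
theorem compactSpace_of_closedImmersion : CompactSpace Z :=
  QuasiCompact.compactSpace_of_compactSpace ι

include ι in
theorem quasiSeparatedSpace_of_closedImmersion : QuasiSeparatedSpace Z :=
  quasiSeparatedSpace_of_quasiSeparated (ι ≫ projSpaceToSpec A k)

theorem exists_sections_equiv_quotient {J : Ideal (MvPolynomial (Fin k) A)}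
    (hJ : J.IsHomogeneous (homogeneousSubmodule (Fin k) A)) (hι : ι.ker = projIdeal J)
    {L : MvPolynomial (Fin k) A} (hL : L ∈ homogeneousSubmodule (Fin k) A 1) :
    letI : Algebra A Γ(Z, ι ⁻¹ᵁ (linOpen L hL).1) := sectionsAlgebra (ι ≫ projSpaceToSpec A k) _
    Nonempty (Γ(Z, ι ⁻¹ᵁ (linOpen L hL).1) ≃ₗ[A]
      MvPolynomial (Fin k) A ⧸ (Ideal.span {L - 1} ⊔ J)) := by
  let : Algebra A Γ(Z, ι ⁻¹ᵁ (linOpen L hL).1) := sectionsAlgebra (ι ≫ projSpaceToSpec A k) _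
  let e := Ideal.quotientKerAlgEquivOfSurjective (schemeSec_surjective ι L hL)
  let e' := Ideal.quotientEquivAlgOfEq A (ker_schemeSec ι L hL hJ hι)
  exact ⟨(e.symm.trans e').toLinearEquiv⟩

theorem exists_globalSections_equiv_quotient {J : Ideal (MvPolynomial (Fin k) A)}
    (hJ : J.IsHomogeneous (homogeneousSubmodule (Fin k) A)) (hι : ι.ker = projIdeal J)
    {L : MvPolynomial (Fin k) A} (hL : L ∈ homogeneousSubmodule (Fin k) A 1)
    (hW : ι ⁻¹ᵁ (linOpen L hL).1 = ⊤) :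
    letI : Algebra A Γ(Z, ⊤) := sectionsAlgebra (ι ≫ projSpaceToSpec A k) ⊤
    Nonempty (Γ(Z, ⊤) ≃ₗ[A] MvPolynomial (Fin k) A ⧸ (Ideal.span {L - 1} ⊔ J)) := by
  have h := exists_sections_equiv_quotient ι hJ hι hL
  rwa [hW] at h

/-- The closed image of a universal projective family, with its Fitting structure, pulls back to the
image of a finite member of the family over a local ring. -/
theorem map_closedFittingImage {K : Type*} [Field K] [Infinite K] {S : Type v} [CommRing S]
    [IsNoetherianRing S] [IsLocalRing A] [Algebra S A] [Algebra K S] [Algebra K A]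
    [IsScalarTower K S A] {Y : Scheme.{v}} (κ : Y ⟶ projSpace S k) [IsClosedImmersion κ]
    {J : Ideal (MvPolynomial (Fin k) S)}
    (hJ : J.IsHomogeneous (homogeneousSubmodule (Fin k) S)) (hκ : κ.ker = projIdeal J)
    (hJ' : (J.map (map (algebraMap S A))).IsHomogeneous (homogeneousSubmodule (Fin k) A))
    (hι : ι.ker = projIdeal (J.map (map (algebraMap S A))))
    [IsFinite (ι ≫ projSpaceToSpec A k)] :
    (closedFittingImage (κ ≫ projSpaceToSpec S k)).map (algebraMap S A) =
      pushforwardFitting (ι ≫ projSpaceToSpec A k) := by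
  have := compactSpace_of_closedImmersion κ
  have := quasiSeparatedSpace_of_closedImmersion κ
  -- The coefficients are taken in K so that the same linear form exists over S and specializes to
  -- the one over A.
  obtain ⟨c, hc⟩ := exists_linForm_preimage_eq_top (K := K) ι
  let L := linForm (algebraMap K S ∘ c)
  have hL : L ∈ homogeneousSubmodule (Fin k) S 1 := linForm_mem _
  have hmap : map (algebraMap S A) L = linForm (algebraMap K A ∘ c) := by
    rw [map_linForm, ← Function.comp_assoc, ← RingHom.coe_comp, ← IsScalarTower.algebraMap_eq]
  have hL' : map (algebraMap S A) L ∈ homogeneousSubmodule (Fin k) A 1 := hmap ▸ linForm_mem _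
  have hc' : ι ⁻¹ᵁ (linOpen (map (algebraMap S A) L) hL').1 = ⊤ := by
    rw [← hc]; congr 3
  let π := κ ≫ projSpaceToSpec S k
  let s : PrimeSpectrum S := PrimeSpectrum.comap (algebraMap S A) (IsLocalRing.closedPoint A)
  have hfib : ∀ z, π z = s → z ∈ κ ⁻¹ᵁ (linOpen L hL).1 := fun z hz =>
    mem_preimage_linOpen_of_map (algebraMap S A) κ ι hJ hκ hJ' hι hL hL'
      (IsLocalRing.maximalIdeal A) (fun z' _ => hc' ▸ trivial) z (congrArg PrimeSpectrum.asIdeal hz)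
  obtain ⟨h, hs, hh⟩ := exists_basicOpen_le κ hL s hfib
  have hsfin : IsFiniteAt π s := isFiniteAt_of_forall_mem κ hL hs hh
  let : Algebra S Γ(Y, ⊤) := sectionsAlgebra π ⊤
  let : Algebra S Γ(Y, κ ⁻¹ᵁ (linOpen L hL).1) := sectionsAlgebra π _
  -- The intersection on the left is `closedFittingImage` unfolded.
  have hI := map_iInf_localFitting Γ(Y, ⊤) {t | IsFiniteAt π t}
    (fun t ht => exists_finite_localizedModule_of_isFiniteAt π ht) hsfin
  have hT : ∀ {w : S}, w ∉ s.asIdeal → Submonoid.powers w ≤ s.asIdeal.primeCompl := fun hw => by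
    rw [Submonoid.powers_le]; exact hw
  have hM : Module.Finite (Localization s.asIdeal.primeCompl)
      (LocalizedModule s.asIdeal.primeCompl Γ(Y, ⊤)) := by
    obtain ⟨w, hw, _⟩ := exists_finite_localizedModule_of_isFiniteAt π hsfin
    exact finite_localizedModule_of_le Γ(Y, ⊤) (hT hw)
  -- After localization at s, where h is invertible, global functions on Y agree with functions on
  -- the affine chart L ≠ 0, and these have an explicit presentation.
  obtain ⟨ρ, hker, hrange⟩ := restriction_torsion π ((linOpen L hL).2.preimage κ) hh
  obtain ⟨e⟩ := exists_localizedModule_equiv s.asIdeal.primeCompl ρ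
    (fun x hx => (hker x hx).elim fun n hn => ⟨h ^ n, hT hs ⟨n, rfl⟩, hn⟩)
    (fun y => (hrange y).elim fun n hn => ⟨h ^ n, hT hs ⟨n, rfl⟩, hn⟩)
  have hN := Module.Finite.equiv e
  obtain ⟨e₁⟩ := exists_sections_equiv_quotient κ hJ hκ hL
  -- The presentation over S tensored with A is the presentation of the functions on Z, all of which
  -- lies in L ≠ 0.
  obtain ⟨f, hf⟩ := exists_isBaseChange_quotient (A := A) (Ideal.span {L - 1} ⊔ J) _ rfl
  obtain ⟨h1, h2⟩ := fittingIdeal_eq_map_localization (hf.comp_equiv e₁ f) s.asIdeal.primeCompl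
    (fun u hu => by
      by_contra hn
      exact hu ((IsLocalRing.mem_maximalIdeal _).2 hn))
    (⨅ t ∈ {t | IsFiniteAt π t}, localFitting Γ(Y, ⊤) t.asIdeal.primeCompl)
    (hI.trans (fittingIdeal_congr e 0).symm)
  refine h1.trans ?_
  have hI' : (Ideal.span {L - 1} ⊔ J).map (map (algebraMap S A)) =
      Ideal.span {map (algebraMap S A) L - 1} ⊔ J.map (map (algebraMap S A)) := by
    rw [Ideal.map_sup, Ideal.map_span, Set.image_singleton, map_sub, map_one]
  obtain ⟨e₂⟩ := exists_globalSections_equiv_quotient ι hJ' hι hL' hc'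
  rw [← hI'] at e₂
  let : Algebra A Γ(Z, ⊤) := sectionsAlgebra (ι ≫ projSpaceToSpec A k) ⊤
  exact (fittingIdeal_congr e₂.symm 0).symm

end Discriminant

/-! ### Leading forms and properness of the ideal of the centre. -/

section LeadingForms

variable {R : Type u} [CommRing R] {k : ℕ} {g : Fin k → R}

theorem IsLeadingForm.isHomogeneous {p : ℕ} {f : R} {F : MvPolynomial (Fin k) (CenterRing g)}
    (h : IsLeadingForm g p f F) : F.IsHomogeneous p := by
  obtain ⟨_, H, hH, _, rfl⟩ := h
  exact hH.map _

theorem centerIdeal_ne_top_of_isRegular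
    (hg : RingTheory.Sequence.IsRegular R (List.ofFn g)) : centerIdeal g ≠ ⊤ := fun h => by
  refine hg.top_ne_smul ?_
  have hr : {x | x ∈ List.ofFn g} = Set.range g := by
    ext x
    exact List.mem_ofFn' g x
  rw [Ideal.ofList, hr, show Ideal.span (Set.range g) = ⊤ from h]
  simp

end LeadingForms

end TransversalDiscriminant

end

open TransversalDiscriminant in
theorem mainTheorem12 {K : Type*} [Field K] [CharZero K]
    {R : Type*} [CommRing R] [IsRegularLocalRing R] [Algebra K R]
    {k r : ℕ} (g : Fin k → R) (hg : RingTheory.Sequence.IsRegular R (List.ofFn g))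
    (IX : Ideal R) (hXZ : IX ≤ centerIdeal g)
    (f : Fin r → R) (p : Fin r → ℕ) (F : Fin r → MvPolynomial (Fin k) (CenterRing g))
    (hf : IsGoodBasis g IX f p F) :
    (critι (conormalIdeal g IX) ((k : ℤ) - 1 - r)).ker =
        projIdeal (Ideal.span (Set.range F) ⊔ jacobianMinors F) ∧
    (AlgebraicGeometry.IsFinite (critToSpec (conormalIdeal g IX) ((k : ℤ) - 1 - r)) →
      transversalDiscriminant K p F =
        pushforwardFitting (critToSpec (conormalIdeal g IX) ((k : ℤ) - 1 - r))) := by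
  have hF : ∀ j, (F j).IsHomogeneous (p j) := fun j => (hf.leading j).isHomogeneous
  rw [← hf.span_leading]
  refine ⟨ker_critι hF, fun hfin => ?_⟩
  -- A regular sequence generates a proper ideal, so 𝒪_Z is a nonzero quotient of a local ring,
  -- hence local.
  have : Nontrivial (CenterRing g) :=
    Ideal.Quotient.nontrivial_iff.2 (centerIdeal_ne_top_of_isRegular hg)
  have : IsLocalRing (CenterRing g) :=
    IsLocalRing.of_surjective' (Ideal.Quotient.mk (centerIdeal g)) Ideal.Quotient.mk_surjective
  let φ : MvPolynomial (CoeffIndex k p) K →ₐ[K] CenterRing g :=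
    aeval fun c : CoeffIndex k p => coeff c.2.1 (F c.1)
  -- With this structure map, the coefficient map of the leading terms, extension of I_Δ to 𝒪_Z is
  -- `transversalDiscriminant` by definition.
  let : Algebra (MvPolynomial (CoeffIndex k p) K) (CenterRing g) := φ.toRingHom.toAlgebra
  have : IsScalarTower K (MvPolynomial (CoeffIndex k p) K) (CenterRing g) :=
    IsScalarTower.of_algebraMap_eq fun a => (φ.commutes a).symm
  have hU := fun j => isHomogeneous_universalForm (k := k) (p := p) K j
  have hmap : (critEquations (universalForm K k p)).map
      (map (algebraMap (MvPolynomial (CoeffIndex k p) K) (CenterRing g))) = critEquations F := by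
    rw [map_critEquations]
    congr 1
    ext1 j
    exact map_universalForm K hF j
  have hfin' : IsFinite (critι (Ideal.span (Set.range F)) ((k : ℤ) - 1 - r) ≫
    projSpaceToSpec (CenterRing g) k) := hfin
  exact map_closedFittingImage (K := K) (critι (Ideal.span (Set.range F)) ((k : ℤ) - 1 - r))
    (critι (Ideal.span (Set.range (universalForm K k p))) ((k : ℤ) - 1 - r))
    (isHomogeneous_critEquations hU) (ker_critι hU)
    (hmap ▸ isHomogeneous_critEquations hF) (hmap ▸ ker_critι hF)
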